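/- Let $(R,\mathfrak m,k)$ be a commutative noetherian local ring and let $M$ be an object of the derived category $\mathbf D(R)$ whose total homology $\bigoplus_i \operatorname{H}_i(M)$ is finitely generated. Let $F$ be a minimal free resolution of $M$: a complex of finitely generated free $R$-modules with $F_i=0$ for $i\ll 0$ and $d(F)\subseteq\mathfrak mF$, isomorphic to $M$ in $\mathbf D(R)$. For $n\in\mathbb Z$ let $\Omega^nM=\Sigma^{-n}F_{\geqslant n}$ be the $n$th syzygy complex of $M$. Let $P$ be a projective resolution of $k$. The stable cohomology $\widehat{\operatorname{Ext}}{}^*_R(k,M)$ is the cohomology of the quotient of the complex $\operatorname{Hom}_R(P,F)$ by the subcomplex of bounded homomorphisms (those whose components on $P_p$ vanish for all $p\gg 0$). Let $$U(M)=\ker\big(\operatorname{Ext}^*_R(k,M)\to\widehat{\operatorname{Ext}}{}^*_R(k,M)\big)$$ be the kernel of the map induced by the projection onto this quotient. For an object $N$ of $\mathbf D(R)$ write $I_R^N(t)=\sum_{i\in\mathbb Z}\operatorname{rank}_k\operatorname{Ext}^i_R(k,N)\,t^i$ for its Bass series, set $I_R(t)=I_R^R(t)$, and write $P^R_M(t)=\sum_{i\in\mathbb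 Z}\beta_i t^i$, with $\beta_i=\operatorname{rank}_k\operatorname{Tor}^R_i(k,M)$, for the Poincaré series of $M$. If $U(M)=0$, then for every integer $n\ge \inf\{i\mid \operatorname{H}_i(M)\neq 0\}+1$ the series $I_R^M(t)$, $I_R(t)$, $I_R^{\Omega^nM}(t)$ and $P^R_M(t)$ are well-defined formal Laurent series (all the ranks are finite, and the Ext and Tor modules in question vanish for $i\ll 0$), and $$I_R^{\Omega^nM}(t)=t^n\,I_R^M(t)+t^{n-1}\Big(\sum_{i<n}\beta_i\,t^{-i}\Big)I_R(t).$$ -/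

import Mathlib

open CategoryTheory

universe w u

noncomputable section

namespace StableCohomology

open CochainComplex HomComplex

/-! ### Stable (Vogel) cohomology of a pair of complexes -/

section

variable {C : Type*} [Category C] [Preadditive C] (K L : CochainComplex C ℤ)

/-- The subgroup of the degree `n` homomorphisms `K → L` that are bounded, that is, whose
components vanish in all sufficiently large homological degrees
(all sufficiently negative cohomological degrees `p`) of the source. -/
def boundedCochain (n : ℤ) : AddSubgroup (Cochain K L n) where
  carrier := {z | ∃ a : ℤ, ∀ (p q : ℤ) (hpq : p + n = q), p < a → z.v p q hpq = 0}
  zero_mem' := ⟨0, fun _ _ _ _ => rfl⟩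
  add_mem' := by
    rintro z₁ z₂ ⟨a, ha⟩ ⟨b, hb⟩
    refine ⟨min a b, fun p q hpq hp => ?_⟩
    rw [Cochain.add_v, ha p q hpq (by lia), hb p q hpq (by lia), add_zero]
  neg_mem' := by
    rintro z ⟨a, ha⟩
    refine ⟨a, fun p q hpq hp => ?_⟩
    rw [Cochain.neg_v, ha p q hpq hp, neg_zero]

lemma δ_mem_boundedCochain (n m : ℤ) (z : Cochain K L n) (hz : z ∈ boundedCochain K L n) :
    δ n m z ∈ boundedCochain K L m := by
  by_cases hnm : n + 1 = m
  · obtain ⟨a, ha⟩ := hz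
    refine ⟨a - 1, fun p q hpq hp => ?_⟩
    rw [δ_v n m hnm z p q hpq (q - 1) (p + 1) rfl rfl, ha _ _ _ (by lia), ha _ _ _ (by lia)]
    simp
  · rw [δ_shape n m hnm]
    exact zero_mem _

/-- The degree `n` part of the quotient complex `Hom(K, L) / Hom(K, L)_bounded`. -/
abbrev StableCochain (n : ℤ) : Type _ := Cochain K L n ⧸ boundedCochain K L n

/-- The differential of `Hom(K, L) / Hom(K, L)_bounded`. -/
def stableδ (n m : ℤ) : StableCochain K L n →+ StableCochain K L m :=
  QuotientAddGroup.map _ _ (δ_hom ℤ K L n m).toAddMonoidHom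
    (fun z hz => δ_mem_boundedCochain K L n m z hz)

/-- The cohomology in degree `n` of `Hom(K, L) / Hom(K, L)_bounded`. When `K` and `L` are projective
resolutions of `X` and `Y` this is the stable cohomology module of the pair `(X, Y)`. -/
abbrev StableClass (n : ℤ) : Type _ :=
  (stableδ K L n (n + 1)).ker ⧸
    ((stableδ K L (n - 1) n).range.addSubgroupOf (stableδ K L n (n + 1)).ker)

/-- The map from cocycles of `Hom(K, L)` to cocycles of `Hom(K, L) / Hom(K, L)_bounded`. -/
def stableCocycle (n : ℤ) : Cocycle K L n →+ (stableδ K L n (n + 1)).ker :=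
  ((QuotientAddGroup.mk' (boundedCochain K L n)).comp
    (Cocycle.toCochainAddMonoidHom K L n)).codRestrict _ (fun z => by
      have h : δ n (n + 1) (z : Cochain K L n) = 0 := z.δ_eq_zero (n + 1)
      change QuotientAddGroup.mk' (boundedCochain K L (n + 1)) (δ n (n + 1) z.1) = 0
      rw [h, map_zero])

/-- The map `H^n(Hom(K, L)) → H^n(Hom(K, L) / Hom(K, L)_bounded)` induced by the projection. -/
def toStable (n : ℤ) : CohomologyClass K L n →+ StableClass K L n :=
  CohomologyClass.descAddMonoidHom
    ((QuotientAddGroup.mk' _).comp (stableCocycle K L n)) (by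
      rintro x ⟨m, hm, β, hβ⟩
      obtain rfl : m = n - 1 := by lia
      refine (QuotientAddGroup.eq_zero_iff _).2 (AddSubgroup.mem_addSubgroupOf.2
        ⟨QuotientAddGroup.mk' _ β, ?_⟩)
      change QuotientAddGroup.mk' (boundedCochain K L n) (δ (n - 1) n β)
        = QuotientAddGroup.mk' (boundedCochain K L n) x.1
      rw [hβ])

end

/-- Morphisms `X ⟶ Y⟦n⟧` in the derived category are the degree `n` cohomology classes of
`Hom(K, L)` when `K` is a K-projective complex isomorphic to `X` and `L` is isomorphic to `Y`. -/
def cohomologyClassEquiv {C : Type*} [Category C] [Abelian C] [HasDerivedCategory.{w} C]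
    {K L : CochainComplex C ℤ} [K.IsKProjective] {X Y : DerivedCategory C}
    (a : DerivedCategory.Q.obj K ≅ X) (b : DerivedCategory.Q.obj L ≅ Y) (n : ℤ) :
    CohomologyClass K L n ≃+ ShiftedHom X Y n :=
  (CohomologyClass.homAddEquiv (K := K) (L := L) (n := n)).trans
    ((AddEquiv.ofBijective (DerivedCategory.Qh.mapAddHom)
      (CochainComplex.IsKProjective.Qh_map_bijective K _)).trans
      { Iso.homCongr ((DerivedCategory.quotientCompQhIso C).app K ≪≫ a)
          ((DerivedCategory.quotientCompQhIso C).app (L⟦n⟧) ≪≫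
            (DerivedCategory.Q.commShiftIso n).app L ≪≫
            (CategoryTheory.shiftFunctor (DerivedCategory C) n).mapIso b) with
        map_add' := fun f g => by simp [Iso.homCongr] })

end StableCohomology

namespace LocalRing

open StableCohomology

variable (R : Type u) [CommRing R] [IsLocalRing R]

local notation "𝔪" => IsLocalRing.maximalIdeal R

/-- The residue field as an `R`-module. -/
abbrev residueModule : ModuleCat.{u} R := ModuleCat.of R (IsLocalRing.ResidueField R)

section DerivedCategory

variable [HasDerivedCategory.{w} (ModuleCat.{u} R)]

/-- The residue field `k` as an object of `D(R)`. -/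
abbrev residueComplex : DerivedCategory (ModuleCat.{u} R) :=
  (DerivedCategory.singleFunctor (ModuleCat.{u} R) 0).obj (residueModule R)

/-- The ring `R` as an object of `D(R)`. -/
abbrev ringComplex : DerivedCategory (ModuleCat.{u} R) :=
  (DerivedCategory.singleFunctor (ModuleCat.{u} R) 0).obj (ModuleCat.of R R)

variable {R}

/-- `H_i(M)`, with homological (lower) indexing. -/
abbrev homology (M : DerivedCategory (ModuleCat.{u} R)) (i : ℤ) : ModuleCat.{u} R :=
  (DerivedCategory.homologyFunctor (ModuleCat.{u} R) (-i)).obj M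

/-- Membership in `D^f_b(R)`: the total homology module is finitely generated. -/
def IsDfb (M : DerivedCategory (ModuleCat.{u} R)) : Prop :=
  (∀ i, Module.Finite R (homology M i)) ∧
    ∃ a b : ℤ, ∀ i, (i < a ∨ b < i) → Subsingleton (homology M i)

/-- `inf H_*(M)` for `M` with bounded homology; it is `⊤` when `H(M) = 0`. -/
def infHomology (M : DerivedCategory (ModuleCat.{u} R)) : WithTop ℤ :=
  sInf ((↑) '' {i : ℤ | Nontrivial (homology M i)})

/-- `Ext^i_R(k, M)`, the group of morphisms `k ⟶ Σ^i M` in `D(R)`. -/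
abbrev E (M : DerivedCategory (ModuleCat.{u} R)) (i : ℤ) : Type w :=
  ShiftedHom (residueComplex R) M i

lemma isTorsionBySet_E (M : DerivedCategory (ModuleCat.{u} R)) (i : ℤ) :
    Module.IsTorsionBySet R (E M i) 𝔪 := by
  rintro (f : residueComplex R ⟶ M⟦i⟧) ⟨r, hr⟩
  have h0 : r • 𝟙 (residueModule R) = 0 := by
    ext x
    change r • x = 0
    rw [Algebra.smul_def]
    have : algebraMap R (IsLocalRing.ResidueField R) r = 0 :=
      (IsLocalRing.residue_eq_zero_iff r).2 hr
    rw [this, zero_mul]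
  have h1 : r • 𝟙 (residueComplex R) = 0 := by
    have h2 := (DerivedCategory.singleFunctor (ModuleCat.{u} R) 0).map_smul (R := R)
      r (𝟙 (residueModule R))
    rw [h0, CategoryTheory.Functor.map_zero, CategoryTheory.Functor.map_id] at h2
    exact h2.symm
  change r • f = 0
  rw [← Category.id_comp f, ← Linear.smul_comp, h1, Limits.zero_comp]

/-- The structure of `k`-vector space on `Ext^i_R(k, M)`: it is the one for which the action of `R`
through `R → k` is the usual one. -/
instance moduleE (M : DerivedCategory (ModuleCat.{u} R)) (i : ℤ) :
    Module (IsLocalRing.ResidueField R) (E M i) :=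
  (isTorsionBySet_E M i).module

/-- The Bass number `μ^i(M) = rank_k Ext^i_R(k, M)`. -/
def bassNumber (M : DerivedCategory (ModuleCat.{u} R)) (i : ℤ) : ℕ :=
  Module.finrank (IsLocalRing.ResidueField R) (E M i)

/-- All `Ext^i_R(k, M)` have finite rank over `k`, and they vanish for `i ≪ 0`. -/
def HasBassSeries (M : DerivedCategory (ModuleCat.{u} R)) : Prop :=
  (∀ i, Module.Finite (IsLocalRing.ResidueField R) (E M i)) ∧
    ∃ a : ℤ, ∀ i < a, Subsingleton (E M i)

end DerivedCategory

open Classical in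
/-- The formal Laurent series `∑ aᵢ tⁱ` (with the value `0` when `aᵢ ≠ 0` for arbitrarily
negative `i`). -/
def laurent (a : ℤ → ℕ) : LaurentSeries ℤ :=
  if h : BddBelow (Function.support fun i => (a i : ℤ)) then
    HahnSeries.ofSuppBddBelow (fun i => (a i : ℤ)) h
  else 0

/-- The monomial `tⁿ`. -/
abbrev tPow (n : ℤ) : LaurentSeries ℤ := HahnSeries.single n 1

/-- For `p(t) = ∑ pᵢ tⁱ` with truncation `[p]_m (t) = ∑_{i ≤ m} pᵢ tⁱ`, this is `[p]_m (t⁻¹)`,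
that is, the Laurent polynomial `∑_{i ≤ m} pᵢ t⁻ⁱ`.
(Coefficients `pᵢ` with `i < p.order` vanish.) -/
def truncInv (p : LaurentSeries ℤ) (m : ℤ) : LaurentSeries ℤ :=
  ∑ i ∈ Finset.Icc p.order m, HahnSeries.single (-i) (p.coeff i)

variable {R}

/-- The functor `k ⊗_R -` from `R`-modules to `k`-vector spaces. -/
abbrev residueTensor : ModuleCat.{u} R ⥤ ModuleCat.{u} (IsLocalRing.ResidueField R) :=
  ModuleCat.extendScalars (IsLocalRing.residue R)

instance : (residueTensor (R := R)).Additive :=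
  (ModuleCat.extendRestrictScalarsAdj (IsLocalRing.residue R)).left_adjoint_additive

section DerivedCategory

variable [HasDerivedCategory.{w} (ModuleCat.{u} R)]

/-- A minimal free resolution of `M`: a complex `F` of finite free modules with `Fᵢ = 0` for `i ≪ 0`
and `d(F) ⊆ 𝔪 F`, isomorphic to `M` in `D(R)`. The component `Fᵢ` is `complex.X (-i)`. -/
structure MinimalFreeResolution (M : DerivedCategory (ModuleCat.{u} R)) where
  /-- the underlying complex -/
  complex : CochainComplex (ModuleCat.{u} R) ℤ
  free : ∀ i, Module.Free R (complex.X i)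
  finite : ∀ i, Module.Finite R (complex.X i)
  bounded : ∃ a : ℤ, ∀ i < a, Subsingleton (complex.X (-i))
  minimal : ∀ (i j : ℤ) (x : complex.X i),
    (complex.d i j).hom x ∈ (𝔪 • ⊤ : Submodule R (complex.X j))
  /-- the isomorphism in the derived category -/
  iso : DerivedCategory.Q.obj complex ≅ M

namespace MinimalFreeResolution

variable {M : DerivedCategory (ModuleCat.{u} R)} (F : MinimalFreeResolution M)

/-- The syzygy complex `Ω^n M = Σ^{-n} F_{≥ n}`, as an object of `D(R)`. -/
def syzygy (n : ℤ) : DerivedCategory (ModuleCat.{u} R) :=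
  DerivedCategory.Q.obj
    ((F.complex.stupidTrunc (ComplexShape.embeddingUpIntLE (-n)))⟦-n⟧)

/-- `Tor_i^R(k, M) = H_i(k ⊗_R F)`. -/
def tor (i : ℤ) : ModuleCat.{u} (IsLocalRing.ResidueField R) :=
  ((residueTensor.mapHomologicalComplex _).obj F.complex).homology (-i)

/-- The Betti number `β_i(M) = rank_k Tor_i^R(k, M)`. -/
def bettiNumber (i : ℤ) : ℕ :=
  Module.finrank (IsLocalRing.ResidueField R) (F.tor i)

/-- All `Tor_i^R(k, M)` have finite rank over `k`, and they vanish for `i ≪ 0`. -/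
def HasPoincareSeries : Prop :=
  (∀ i, Module.Finite (IsLocalRing.ResidueField R) (F.tor i)) ∧
    ∃ a : ℤ, ∀ i < a, Subsingleton (F.tor i)

/-- The Poincaré series `P_M(t) = ∑ β_i(M) tⁱ`. -/
def poincareSeries : LaurentSeries ℤ := laurent F.bettiNumber

end MinimalFreeResolution

/-- The Bass series `I^M(t) = ∑ μ^i(M) tⁱ`. -/
def bassSeries (M : DerivedCategory (ModuleCat.{u} R)) : LaurentSeries ℤ :=
  laurent (bassNumber M)

variable (R) in
/-- A projective resolution of the residue field. -/
def residueResolution : ProjectiveResolution (residueModule R) :=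
  projectiveResolution (residueModule R)

variable (R) in
instance : (residueResolution R).cochainComplex.IsKProjective :=
  CochainComplex.isKProjective_of_projective _ 0

variable (R) in
/-- The isomorphism in `D(R)` from the projective resolution of `k` to `k`. -/
def residueResolutionIso :
    DerivedCategory.Q.obj (residueResolution R).cochainComplex ≅ residueComplex R :=
  asIso (DerivedCategory.Q.map (residueResolution R).π') ≪≫
    ((DerivedCategory.singleFunctorIsoCompQ (ModuleCat.{u} R) 0).app _).symm

namespace MinimalFreeResolution

variable {M : DerivedCategory (ModuleCat.{u} R)} (F : MinimalFreeResolution M)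

/-- The stable cohomology `Êxt^i_R(k, M)`. -/
abbrev stableE (i : ℤ) : Type u :=
  StableClass (residueResolution R).cochainComplex F.complex i

/-- The natural map `ι(M) : Ext^i_R(k, M) → Êxt^i_R(k, M)`. -/
def iota (i : ℤ) : E M i →+ F.stableE i :=
  (toStable (residueResolution R).cochainComplex F.complex i).comp
    (cohomologyClassEquiv (residueResolutionIso R) F.iso i).symm.toAddMonoidHom

/-- The unstable elements `U^i(M) = ker (ι(M) : Ext^i_R(k, M) → Êxt^i_R(k, M))`. -/
def U (i : ℤ) : AddSubgroup (E M i) := (F.iota i).ker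

end MinimalFreeResolution

end DerivedCategory

end LocalRing

end

/-! ### Ext classes represented by cochains -/

noncomputable section

namespace StableCohomology

open CochainComplex HomComplex

/-! Everything comes from the triangle `F_{<n} ⟶ F ⟶ F_{≥n} ⟶` and its long exact sequence under
`Ext(k, -)`. A class in `Ext(k, M)` that factors through `F_{<n}` is represented by a bounded
homomorphism `P ⟶ F`, hence is unstable. If `U(M) = 0`, the maps `Ext(k, F_{<n}) → Ext(k, M)`
therefore vanish (`postcomp_eq_zero_of_U_eq_bot`), the sequence splits into short exact ones, and
the Bass numbers of `F_{≥n}` are those of `M` plus the shifted ones of `F_{<n}`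
(`finite_E_syzygy_and_bassNumber`).

It remains to show that a bounded minimal complex `G` of finite free modules has the same Bass
numbers as the direct sum of its shifted components (`finite_E_and_finrank_of_bounded`). By
induction on the length, it suffices that `Ext(k, G)` maps onto the `Ext` of the component in lowest
cohomological degree (`surjective_postcomp_of_isMinimalFree`). A cocycle `z` with values in that
component is lifted to a sum of terms `φ ∘ z ∘ e`, where the `e` are basis elements of the
components of `G` and the `φ` are endomorphisms of `P` forming a system of higher homotopies
(`exists_higher_homotopies`). These start from the identity: entries of the first differential lie
in `𝔪` and so act null-homotopically on `P`, and all further obstructions lie in `Ext^{<0}(k, k) =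
0`.

Finiteness follows by choosing a truncation for which `F_{≥n}` is a shifted finitely generated
module, and Betti numbers are ranks of the `F_i` by minimality. -/

lemma cohomologyClassEquiv_mk {C : Type*} [Category C] [Abelian C] [HasDerivedCategory.{w} C]
    {K L : CochainComplex C ℤ} [K.IsKProjective] {X Y : DerivedCategory C}
    (a : DerivedCategory.Q.obj K ≅ X) (b : DerivedCategory.Q.obj L ≅ Y) (n : ℤ)
    (z : Cocycle K L n) :
    cohomologyClassEquiv a b n (CohomologyClass.mk z) =
      a.inv ≫ DerivedCategory.Q.map (Cocycle.equivHomShift.symm z) ≫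
        (DerivedCategory.Q.commShiftIso n).hom.app L ≫ b.hom⟦n⟧' := by
  change (((DerivedCategory.quotientCompQhIso C).app K ≪≫ a).inv ≫
    DerivedCategory.Qh.map ((HomotopyCategory.quotient C _).map
      (Cocycle.equivHomShift.symm z)) ≫ _ : _ ⟶ _) = _
  have h := (DerivedCategory.quotientCompQhIso C).hom.naturality (Cocycle.equivHomShift.symm z)
  dsimp at h ⊢
  rw [Category.assoc, reassoc_of% h]
  simp

/-- Naturality in the target: it lets maps between `Ext` groups be computed, and lifted, on
cochains. -/
lemma cohomologyClassEquiv_postcomp {C : Type*} [Category C] [Abelian C]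
    [HasDerivedCategory.{w} C] {K L L' : CochainComplex C ℤ} [K.IsKProjective]
    {X Y Y' : DerivedCategory C} (a : DerivedCategory.Q.obj K ≅ X)
    (b : DerivedCategory.Q.obj L ≅ Y) (b' : DerivedCategory.Q.obj L' ≅ Y') (n : ℤ)
    (z : Cocycle K L n) (g : L ⟶ L') :
    cohomologyClassEquiv a b' n (CohomologyClass.mk (z.postcomp g)) =
      cohomologyClassEquiv a b n (CohomologyClass.mk z) ≫
        (b.inv ≫ DerivedCategory.Q.map g ≫ b'.hom)⟦n⟧' := by
  have h : Cocycle.equivHomShift.symm (z.postcomp g) =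
      Cocycle.equivHomShift.symm z ≫ g⟦n⟧' := by
    ext i
    simp only [Cocycle.equivHomShift_symm_apply, Cocycle.homOf_f, Cocycle.rightShift_coe,
      HomologicalComplex.comp_f, Cochain.rightShift_v _ _ _ _ i i _ (i + n) rfl]
    simp only [Cocycle.postcomp_coe, Cochain.comp_zero_cochain_v, Cochain.ofHom_v,
      shiftFunctor_map_f', shiftFunctorObjXIso, HomologicalComplex.XIsoOfEq_rfl, Iso.refl_inv]
    exact (Category.comp_id _).trans (congrArg (· ≫ g.f (i + n)) (Category.comp_id _).symm)
  have h' := (DerivedCategory.Q.commShiftIso n).hom.naturality g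
  dsimp at h'
  rw [cohomologyClassEquiv_mk, cohomologyClassEquiv_mk, h, Functor.map_comp, Functor.map_comp,
    Functor.map_comp]
  simp only [Category.assoc]
  rw [reassoc_of% h', Iso.map_hom_inv_id_assoc]

end StableCohomology

/-! ### Long exact sequences of `k`-vector spaces -/

namespace LocalRing

open StableCohomology

variable {R : Type u} [CommRing R] [IsLocalRing R] [HasDerivedCategory.{w} (ModuleCat.{u} R)]

local notation "𝔪" => IsLocalRing.maximalIdeal R
local notation "𝓀" => IsLocalRing.ResidueField R

/-- The `k`-linear map `Ext^i(k, M) → Ext^j(k, N)` obtained by composition with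
`M⟦i⟧ ⟶ N⟦j⟧`. -/
def E.postcomp {M N : DerivedCategory (ModuleCat.{u} R)} {i j : ℤ} (g : M⟦i⟧ ⟶ N⟦j⟧) :
    E M i →ₗ[𝓀] E N j where
  toFun α := α ≫ g
  map_add' α β := Preadditive.add_comp _ _ _ _ _ _
  map_smul' r α := by
    obtain ⟨r, rfl⟩ := IsLocalRing.residue_surjective r
    exact Linear.smul_comp (R := R) _ _ _ r α g

lemma E.postcomp_apply {M N : DerivedCategory (ModuleCat.{u} R)} {i j : ℤ} (g : M⟦i⟧ ⟶ N⟦j⟧)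
    (α : E M i) : E.postcomp g α = (α : _ ⟶ _) ≫ g := rfl

/-- Isomorphic targets have isomorphic `Ext` spaces. -/
def E.congr {M N : DerivedCategory (ModuleCat.{u} R)} {i j : ℤ} (e : M⟦i⟧ ≅ N⟦j⟧) :
    E M i ≃ₗ[𝓀] E N j :=
  LinearEquiv.ofLinearMap (E.postcomp e.hom) (E.postcomp e.inv)
    (by ext α; simp [E.postcomp_apply]) (by ext α; simp [E.postcomp_apply])

section LongExactSequence

open Pretriangulated

variable {T : Triangle (DerivedCategory (ModuleCat.{u} R))}

/-- The connecting map of the long exact sequence of a distinguished triangle. -/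
def E.connecting (T : Triangle (DerivedCategory (ModuleCat.{u} R))) (i j : ℤ) (h : i + 1 = j) :
    E T.obj₃ i →ₗ[𝓀] E T.obj₁ j :=
  E.postcomp (T.mor₃⟦i⟧' ≫ (shiftFunctorAdd' _ 1 i j (by lia)).inv.app _)

lemma E.exact₂ (hT : T ∈ distTriang _) (i : ℤ) :
    Function.Exact (E.postcomp (i := i) (T.mor₁⟦i⟧')) (E.postcomp (T.mor₂⟦i⟧')) := by
  have := (preadditiveCoyoneda.obj (Opposite.op (residueComplex R))).homologySequence_exact₂ T hT i
  rw [ShortComplex.ab_exact_iff_function_exact] at this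
  exact this

lemma E.exact₃ (hT : T ∈ distTriang _) (i j : ℤ) (h : i + 1 = j) :
    Function.Exact (E.postcomp (i := i) (T.mor₂⟦i⟧')) (E.connecting T i j h) := by
  have := (preadditiveCoyoneda.obj (Opposite.op (residueComplex R))).homologySequence_exact₃
    T hT i j h
  rw [ShortComplex.ab_exact_iff_function_exact] at this
  convert! this using 1
  ext x
  exact (preadditiveCoyoneda_homologySequenceδ_apply T i j h x).symm

lemma E.exact₁ (hT : T ∈ distTriang _) (i j : ℤ) (h : i + 1 = j) :
    Function.Exact (E.connecting T i j h) (E.postcomp (i := j) (T.mor₁⟦j⟧')) := by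
  have := (preadditiveCoyoneda.obj (Opposite.op (residueComplex R))).homologySequence_exact₁
    T hT i j h
  rw [ShortComplex.ab_exact_iff_function_exact] at this
  convert! this using 1
  ext x
  exact (preadditiveCoyoneda_homologySequenceδ_apply T i j h x).symm

end LongExactSequence

end LocalRing
end

/-! ### The action of `𝔪` on a resolution of `k`, and `Ext` into free modules -/

noncomputable section

namespace LocalRing

open StableCohomology CochainComplex HomComplex

variable {R : Type u} [CommRing R] [IsLocalRing R] [HasDerivedCategory.{w} (ModuleCat.{u} R)]

local notation "𝔪" => IsLocalRing.maximalIdeal R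
local notation "𝓀" => IsLocalRing.ResidueField R

lemma smul_E_eq_zero {M : DerivedCategory (ModuleCat.{u} R)} {i : ℤ} (α : E M i) {r : R}
    (hr : r ∈ 𝔪) : r • α = 0 :=
  isTorsionBySet_E M i (x := α) (a := ⟨r, hr⟩)

open DerivedCategory in
-- Orthogonality of the t-structure: `k` lies in degrees `≤ 0` and `M⟦i⟧` in degrees `≥ a - i > 0`.
lemma subsingleton_E_of_isGE (M : DerivedCategory (ModuleCat.{u} R)) (a i : ℤ) [M.IsGE a]
    (hi : i < a) : Subsingleton (E M i) := by
  have h1 : (M⟦i⟧).IsGE (a - i) := TStructure.t.isGE_shift M a i (a - i) (by lia)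
  refine subsingleton_of_forall_eq 0 fun α => ?_
  exact TStructure.t.zero_of_isLE_of_isGE (α : residueComplex R ⟶ M⟦i⟧) 0 (a - i) (by lia)
    inferInstance h1

variable (R) in
-- The class of `r • 𝟙` lies in `Ext^0(k, k)`, which `𝔪` annihilates.
lemma exists_δ_eq_smul_id {r : R} (hr : r ∈ 𝔪) :
    ∃ β : Cochain (residueResolution R).cochainComplex (residueResolution R).cochainComplex (-1),
      δ (-1) 0 β = r • Cochain.ofHom (𝟙 _) := by
  let P := (residueResolution R).cochainComplex
  have : CohomologyClass.mk ((Cocycle.ofHom (𝟙 P)).postcomp (r • 𝟙 P)) = 0 := by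
    apply (cohomologyClassEquiv (residueResolutionIso R) (residueResolutionIso R) 0).injective
    rw [cohomologyClassEquiv_postcomp _ (residueResolutionIso R), map_zero, Functor.map_smul]
    simp only [Linear.smul_comp, Linear.comp_smul, Functor.map_smul]
    exact smul_E_eq_zero _ hr
  rw [CohomologyClass.mk_eq_zero_iff, mem_coboundaries_iff _ (-1) (by simp)] at this
  obtain ⟨β, hβ⟩ := this
  refine ⟨β, hβ.trans ?_⟩
  ext p : 1
  simp only [Cocycle.postcomp_coe, Cocycle.ofHom_coe, Cochain.comp_zero_cochain_v, Cochain.ofHom_v,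
    Cochain.smul_v, HomologicalComplex.smul_f_apply, HomologicalComplex.id_f]
  exact Category.id_comp _

variable (R) in
-- `Hom(P, P)` computes `Ext(k, k)`, which is zero in negative degrees.
lemma exists_δ_eq_of_neg {n m : ℤ} (hn : n < 0) (hm : m + 1 = n)
    (z : Cochain (residueResolution R).cochainComplex (residueResolution R).cochainComplex n)
    (hz : δ n (n + 1) z = 0) :
    ∃ β : Cochain (residueResolution R).cochainComplex (residueResolution R).cochainComplex m,
      δ m n β = z := by
  have : CohomologyClass.mk (Cocycle.mk z (n + 1) rfl hz) = 0 := by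
    apply (cohomologyClassEquiv (residueResolutionIso R) (residueResolutionIso R) n).injective
    exact (subsingleton_E_of_isGE (residueComplex R) 0 n hn).elim _ _
  rwa [CohomologyClass.mk_eq_zero_iff, mem_coboundaries_iff _ m hm] at this

/-- The decomposition of `Ext^i(k, Φ V)` for an additive functor `Φ` and a free module `V`. -/
def E.freeEquiv {ι : Type*} [Fintype ι] {V : ModuleCat.{u} R} (b : Module.Basis ι R V) (c i : ℤ) :
    E ((DerivedCategory.singleFunctor (ModuleCat.{u} R) c).obj V) i ≃ₗ[𝓀]
      (ι → E ((DerivedCategory.singleFunctor (ModuleCat.{u} R) c).obj (ModuleCat.of R R)) i) := by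
  classical
  let Φ := DerivedCategory.singleFunctor (ModuleCat.{u} R) c ⋙
    CategoryTheory.shiftFunctor (DerivedCategory (ModuleCat.{u} R)) i
  let p (l : ι) : V ⟶ ModuleCat.of R R := ModuleCat.ofHom (b.coord l)
  let s (l : ι) : ModuleCat.of R R ⟶ V := ModuleCat.ofHom (LinearMap.toSpanSingleton R V (b l))
  have hsp (l l' : ι) : s l ≫ p l' = if l = l' then 𝟙 _ else 0 := by
    ext
    by_cases h : l = l' <;> simp [s, p, h]
  have hps : ∑ l, p l ≫ s l = 𝟙 V := by
    ext x
    simp [s, p, ModuleCat.hom_sum, b.sum_repr x]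
  refine LinearEquiv.ofLinearMap (LinearMap.pi fun l => E.postcomp (Φ.map (p l)))
    (∑ l, E.postcomp (Φ.map (s l)) ∘ₗ LinearMap.proj l) ?_ ?_
  · refine LinearMap.ext fun f => funext fun l => ?_
    have (l' : ι) : E.postcomp (Φ.map (p l)) (E.postcomp (Φ.map (s l')) (f l')) =
        if l' = l then f l' else 0 := by
      rw [E.postcomp_apply, E.postcomp_apply, Category.assoc, ← Φ.map_comp, hsp]
      split_ifs
      · rw [Φ.map_id]; exact Category.comp_id _
      · rw [Φ.map_zero]; exact Limits.comp_zero
    simp [this]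
  · refine LinearMap.ext fun α => ?_
    have (l : ι) : E.postcomp (Φ.map (s l)) (E.postcomp (Φ.map (p l)) α) =
        E.postcomp (Φ.map (p l ≫ s l)) α := by
      rw [E.postcomp_apply, E.postcomp_apply, Category.assoc, ← Φ.map_comp]
      rfl
    simp only [LinearMap.comp_apply, LinearMap.sum_apply, LinearMap.proj_apply, LinearMap.pi_apply,
      this, LinearMap.id_apply]
    have h : ∑ l, E.postcomp (Φ.map (p l ≫ s l)) α =
        (α : residueComplex R ⟶ Φ.obj V) ≫ ∑ l, Φ.map (p l ≫ s l) :=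
      (Preadditive.comp_sum _ _ _).symm
    rw [h, ← Φ.map_sum, hps, Φ.map_id]
    exact Category.comp_id _

/-- `Ext^i(k, Σ^{-c} V) = Ext^j(k, Σ^{-d} V)` for `i - c = j - d`. -/
def E.singleShift (V : ModuleCat.{u} R) (c d i j : ℤ) (h : i + d = j + c) :
    E ((DerivedCategory.singleFunctor (ModuleCat.{u} R) c).obj V) i ≃ₗ[𝓀]
      E ((DerivedCategory.singleFunctor (ModuleCat.{u} R) d).obj V) j :=
  E.congr
    ((((DerivedCategory.singleFunctors (ModuleCat.{u} R)).shiftIso i (c - i) c (by lia)).app V) ≪≫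
    (((DerivedCategory.singleFunctors (ModuleCat.{u} R)).shiftIso j (c - i) d (by lia)).app V).symm)

end LocalRing
end

/-! ### Higher homotopies -/

noncomputable section

namespace StableCohomology

open CochainComplex HomComplex

section Sums

variable {C : Type*} [Category C] [Preadditive C] {F G K : CochainComplex C ℤ} {ι : Type*}

lemma Cochain.sum_comp {n₁ n₂ n₁₂ : ℤ} (s : Finset ι) (f : ι → Cochain F G n₁)
    (z : Cochain G K n₂) (h : n₁ + n₂ = n₁₂) :
    (∑ l ∈ s, f l).comp z h = ∑ l ∈ s, (f l).comp z h :=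
  map_sum (AddMonoidHom.mk' (fun x : Cochain F G n₁ => x.comp z h)
    (fun _ _ => Cochain.add_comp _ _ _ _)) f s

lemma Cochain.comp_sum {n₁ n₂ n₁₂ : ℤ} (s : Finset ι) (z : Cochain F G n₁)
    (f : ι → Cochain G K n₂) (h : n₁ + n₂ = n₁₂) :
    z.comp (∑ l ∈ s, f l) h = ∑ l ∈ s, z.comp (f l) h :=
  map_sum (AddMonoidHom.mk' (fun x : Cochain G K n₂ => z.comp x h)
    (fun _ _ => Cochain.comp_add _ _ _ _)) f s

lemma Cochain.sum_v {n : ℤ} (s : Finset ι) (f : ι → Cochain F G n) (p q : ℤ) (hpq : p + n = q) :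
    (∑ l ∈ s, f l).v p q hpq = ∑ l ∈ s, (f l).v p q hpq :=
  map_sum (AddMonoidHom.mk' (fun x : Cochain F G n => x.v p q hpq) (fun _ _ => rfl)) f s

end Sums

section Operators

variable {R : Type*} [CommRing R] {C : Type*} [Category C] [Preadditive C] [Linear R C]
  {P G : CochainComplex C ℤ} {ι : ℕ → Type*} [∀ s, Fintype (ι s)]
  (a : ∀ s, ι s → ι (s + 1) → R)

/-- Let `a` be the matrices of the differentials of a complex of free modules, with entries of the
first one acting on `P` as null-homotopic maps. When `Hom(P, P)` has no cohomology in
negative degrees, the multiples of the identity given by a basis element of the first module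
extend to a system of higher homotopies. -/
lemma exists_higher_homotopies [DecidableEq (ι 0)] (ε : ℕ → ℤˣ) (l₀ : ι 0)
    (h₀ : ∀ l, ∃ β : Cochain P P (-1), δ (-1) 0 β = a 0 l₀ l • Cochain.ofHom (𝟙 P))
    (hneg : ∀ n m : ℤ, n < 0 → m + 1 = n → ∀ z : Cochain P P n, δ n (n + 1) z = 0 →
      ∃ β : Cochain P P m, δ m n β = z)
    (ha : ∀ s l l'', ∑ l', a s l l' * a (s + 1) l' l'' = 0) :
    ∃ φ : ∀ s : ℕ, ι s → Cochain P P (-(s : ℤ)),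
      (∀ l p, (φ 0 l).v p p (by simp) = if l = l₀ then 𝟙 _ else 0) ∧
      ∀ (s : ℕ) (l' : ι (s + 1)), δ (-((s + 1 : ℕ) : ℤ)) (-(s : ℤ)) (φ (s + 1) l') =
        ε s • ∑ l, a s l l' • φ s l := by
  -- Carrying solvability of the next equation as an invariant makes the recursion possible.
  let Inv (s : ℕ) (φ : ι s → Cochain P P (-(s : ℤ))) : Prop :=
    ∀ l', ∃ β : Cochain P P (-((s + 1 : ℕ) : ℤ)),
      δ (-((s + 1 : ℕ) : ℤ)) (-(s : ℤ)) β = ε s • ∑ l, a s l l' • φ l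
  have step (s : ℕ) (φ : {φ // Inv s φ}) : ∃ φ' : {φ' // Inv (s + 1) φ'},
      ∀ l', δ (-((s + 1 : ℕ) : ℤ)) (-(s : ℤ)) (φ'.1 l') = ε s • ∑ l, a s l l' • φ.1 l := by
    choose φ' hφ' using φ.2
    -- The next right-hand side has degree `-(s + 1) < 0`, so it is a coboundary once it is a
    -- cocycle, which follows from `ha`. Only stage `0`, in degree zero, needs the null-homotopies
    -- `h₀`.
    refine ⟨⟨φ', fun l'' => ?_⟩, hφ'⟩
    refine hneg _ _ (by lia) (by lia) _ ?_
    rw [show (-((s + 1 : ℕ) : ℤ)) + 1 = -(s : ℤ) by lia, δ_units_smul]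
    have : δ (-((s + 1 : ℕ) : ℤ)) (-(s : ℤ)) (∑ l', a (s + 1) l' l'' • φ' l') = 0 := by
      have h (l' : ι (s + 1)) : a (s + 1) l' l'' • (ε s • ∑ l, a s l l' • φ.1 l) =
          ε s • ∑ l, (a s l l' * a (s + 1) l' l'') • φ.1 l := by
        rw [smul_comm, Finset.smul_sum]
        simp only [smul_smul, mul_comm]
      rw [← δ_hom_apply R, map_sum]
      simp only [map_smul, δ_hom_apply, hφ', h]
      rw [← Finset.smul_sum, Finset.sum_comm]
      simp only [← Finset.sum_smul, ha, zero_smul, Finset.sum_const_zero, smul_zero]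
    rw [this, smul_zero]
  let φ₀ (l : ι 0) : Cochain P P (-((0 : ℕ) : ℤ)) :=
    if l = l₀ then (Cochain.ofHom (𝟙 P) : Cochain P P 0) else 0
  have inv₀ : Inv 0 φ₀ := fun l' => by
    obtain ⟨β, hβ⟩ := h₀ l'
    refine ⟨ε 0 • β, ?_⟩
    rw [δ_units_smul]
    congr 1
    refine Eq.trans hβ ?_
    simp [φ₀]
  choose next hnext using step
  let Φ : ∀ s, {φ // Inv s φ} := fun s => Nat.rec ⟨φ₀, inv₀⟩ (fun s φ => next s φ) s
  refine ⟨fun s => (Φ s).1, fun l p => ?_, fun s l' => hnext s (Φ s) l'⟩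
  change (φ₀ l).v p p _ = _
  by_cases h : l = l₀
  · simp only [φ₀, h, if_true]
    exact Cochain.ofHom_v _ _
  · simp only [φ₀, h, if_false]
    rfl

/-- By the Leibniz rule stage `s` contributes `A s` (differentiating `y`) and `B s` (differentiating
`φ`). These telescope, and the last term is an empty sum because the complex ends at stage `N`. -/
lemma δ_sum_higher_homotopies_comp {i : ℤ} (φ : ∀ s : ℕ, ι s → Cochain P P (-(s : ℤ)))
    (y : ∀ s : ℕ, ι s → Cochain P G (i + s))
    (hφ₀ : ∀ l, δ (-((0 : ℕ) : ℤ)) 1 (φ 0 l) = 0)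
    (hφ : ∀ (s : ℕ) (l' : ι (s + 1)), δ (-((s + 1 : ℕ) : ℤ)) (-(s : ℤ)) (φ (s + 1) l') =
        (i + s).negOnePow • ∑ l, a s l l' • φ s l)
    (hy : ∀ (s : ℕ) (l : ι s), δ (i + s) (i + (s + 1 : ℕ)) (y s l) = ∑ l', a s l l' • y (s + 1) l')
    (N : ℕ) [IsEmpty (ι N)] :
    δ i (i + 1) (∑ s ∈ Finset.range N, ∑ l, (φ s l).comp (y s l) (by lia)) = 0 := by
  let A (s : ℕ) : Cochain P G (i + 1) :=
    ∑ l, (φ s l).comp (δ (i + s) (i + (s + 1 : ℕ)) (y s l)) (by lia)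
  let B (s : ℕ) : Cochain P G (i + 1) :=
    ∑ l, (i + s).negOnePow • (δ (-(s : ℤ)) (1 - s) (φ s l)).comp (y s l) (by lia)
  have hAB (s : ℕ) : δ i (i + 1) (∑ l, (φ s l).comp (y s l) (by lia)) = A s + B s := by
    rw [← δ_hom_apply ℤ, map_sum, ← Finset.sum_add_distrib]
    refine Finset.sum_congr rfl fun l _ => ?_
    rw [δ_hom_apply, δ_comp _ _ _ (1 - (s : ℤ)) (i + (s + 1 : ℕ)) (i + 1) rfl (by lia) (by lia)]
  have hB₀ : B 0 = 0 := by
    refine Finset.sum_eq_zero fun l _ => ?_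
    have := hφ₀ l
    rw [show δ (-((0 : ℕ) : ℤ)) (1 - ((0 : ℕ) : ℤ)) (φ 0 l) = 0 from hφ₀ l, Cochain.zero_comp,
      smul_zero]
  -- The Leibniz sign `(-1)^(i+s+1)` times the sign `(-1)^(i+s)` built into `hφ` is `-1`.
  have hB (s : ℕ) : B (s + 1) = -A s := by
    have h (l' : ι (s + 1)) (m : ℤ) (hm : m = -(s : ℤ)) (hm' : m + (i + (s + 1 : ℕ)) = i + 1) :
        (δ (-((s + 1 : ℕ) : ℤ)) m (φ (s + 1) l')).comp (y (s + 1) l') hm' =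
          (i + s).negOnePow • ∑ l, a s l l' • (φ s l).comp (y (s + 1) l') (by lia) := by
      subst hm
      rw [hφ, Cochain.units_smul_comp]
      congr 1
      rw [Cochain.sum_comp]
      simp only [Cochain.smul_comp]
    have h' (l : ι s) : (φ s l).comp (δ (i + s) (i + (s + 1 : ℕ)) (y s l)) (by lia) =
        ∑ l', a s l l' • (φ s l).comp (y (s + 1) l') (show _ = i + 1 by lia) := by
      rw [hy, Cochain.comp_sum]
      simp only [Cochain.comp_smul]
    simp only [A, B, h']
    rw [Finset.sum_comm, ← Finset.sum_neg_distrib]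
    refine Finset.sum_congr rfl fun l' _ => ?_
    rw [h l' _ (by lia), smul_smul, ← Int.negOnePow_add,
      show i + ((s + 1 : ℕ) : ℤ) + (i + s) = 2 * (i + s) + 1 by lia, Int.negOnePow_succ,
      Int.negOnePow_two_mul]
    simp
  have key (n : ℕ) :
      δ i (i + 1) (∑ s ∈ Finset.range n, ∑ l, (φ s l).comp (y s l) (by lia)) = -B n := by
    induction n with
    | zero => simp [hB₀]
    | succ n ih => rw [Finset.sum_range_succ, δ_add, ih, hAB, hB]; abel
  rw [key]
  simp [B]

end Operators

end StableCohomology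
end

/-! ### Lifting a cocycle from the lowest component -/

noncomputable section

namespace StableCohomology

open CochainComplex HomComplex

lemma Cochain.fromSingleMk_sum_smul {R : Type*} [CommRing R] {C : Type*} [Category C]
    [Preadditive C] [Linear R C] [Limits.HasZeroObject C] {K : CochainComplex C ℤ} {X : C}
    {ι : Type*} (s : Finset ι) (r : ι → R) {p q n : ℤ} (f : ι → (X ⟶ K.X q)) (h : p + n = q) :
    Cochain.fromSingleMk (∑ l ∈ s, r l • f l) h = ∑ l ∈ s, r l • Cochain.fromSingleMk (f l) h := by
  refine (map_sum (Cochain.fromSingleEquiv h).symm _ s).trans (Finset.sum_congr rfl fun l _ => ?_)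
  apply (Cochain.fromSingleEquiv h).injective
  rw [AddEquiv.apply_symm_apply]
  simp only [Cochain.fromSingleEquiv, AddEquiv.coe_mk, Equiv.coe_fn_mk, Cochain.smul_v,
    Cochain.fromSingleMk_v]
  refine Eq.trans ?_ (Linear.comp_smul _ _ _ _ _ _).symm
  exact congrArg (fun g : X ⟶ K.X q => r l • g) (Iso.inv_hom_id_assoc _ _).symm

end StableCohomology

namespace LocalRing

open StableCohomology CochainComplex HomComplex

lemma _root_.Module.Basis.repr_mem_of_mem_smul_top {R V ι : Type*} [CommRing R] [AddCommGroup V]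
    [Module R V] (b : Module.Basis ι R V) (I : Ideal R) {x : V}
    (hx : x ∈ (I • ⊤ : Submodule R V)) (l : ι) : b.repr x l ∈ I := by
  induction hx using Submodule.smul_induction_on' with
  | smul r hr v _ => simpa using I.mul_mem_right _ hr
  | add x _ y _ hx hy => simpa using I.add_mem hx hy

variable {R : Type u} [CommRing R] [IsLocalRing R]

local notation "𝔪" => IsLocalRing.maximalIdeal R
local notation "𝓀" => IsLocalRing.ResidueField R

variable [HasDerivedCategory.{w} (ModuleCat.{u} R)]

/-- Following `z` by the basis element `b 0 l₀` need not give a cocycle in `G`, since `d (b 0 l₀)`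
may be nonzero. The higher homotopies supply correction terms in degrees above `c`, leaving the
component in degree `c` unchanged. -/
lemma exists_cocycle_lift_of_basis (G : CochainComplex (ModuleCat.{u} R) ℤ) (c : ℤ) (N : ℕ)
    {ι : ℕ → Type*} [∀ s, Fintype (ι s)] [IsEmpty (ι N)]
    (b : ∀ s : ℕ, Module.Basis (ι s) R (G.X (c + s)))
    (hG : ∀ x, (G.d (c + (0 : ℕ)) (c + (0 + 1 : ℕ))).hom x ∈ (𝔪 • ⊤ : Submodule R _))
    {i j : ℤ} (hij : j + c = i)
    (z : Cocycle (residueResolution R).cochainComplex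
      ((singleFunctor (ModuleCat.{u} R) 0).obj (ModuleCat.of R R)) j) (l₀ : ι 0) :
    ∃ w : Cocycle (residueResolution R).cochainComplex G i, ∀ p (h : p + j = 0),
      w.1.v p (c + (0 : ℕ)) (by lia) = z.1.v p 0 h ≫
        (HomologicalComplex.singleObjXSelf (.up ℤ) 0 (ModuleCat.of R R)).hom ≫
          ModuleCat.ofHom (LinearMap.toSpanSingleton R _ (b 0 l₀)) := by
  classical
  let a (s : ℕ) (l : ι s) (l' : ι (s + 1)) : R :=
    (b (s + 1)).repr ((G.d (c + s) (c + (s + 1 : ℕ))).hom (b s l)) l'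
  have had (s : ℕ) (l : ι s) : (G.d (c + s) (c + (s + 1 : ℕ))).hom (b s l) =
      ∑ l', a s l l' • b (s + 1) l' := ((b (s + 1)).sum_repr _).symm
  have ha (s : ℕ) (l : ι s) (l'' : ι (s + 1 + 1)) :
      ∑ l', a s l l' * a (s + 1) l' l'' = 0 := by
    have h : (G.d (c + (s + 1 : ℕ)) (c + (s + 1 + 1 : ℕ))).hom
        ((G.d (c + s) (c + (s + 1 : ℕ))).hom (b s l)) = 0 :=
      LinearMap.congr_fun (congrArg ModuleCat.Hom.hom (G.d_comp_d _ _ _)) (b s l)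
    rw [had, map_sum] at h
    replace h := congrArg (fun x => (b (s + 1 + 1)).repr x l'') h
    simp only [map_smul, map_sum, map_zero, Finsupp.finsetSum_apply, Finsupp.smul_apply,
      Finsupp.zero_apply, smul_eq_mul] at h
    exact h
  obtain ⟨φ, hφ₀, hφ⟩ := exists_higher_homotopies (P := (residueResolution R).cochainComplex) a
    (fun s => (i + s).negOnePow) l₀
    (fun l => exists_δ_eq_smul_id R ((b (0 + 1)).repr_mem_of_mem_smul_top 𝔪 (hG _) l))
    (fun n m hn hm z hz => exists_δ_eq_of_neg R hn hm z hz) ha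
  -- The basis elements, viewed as cochains out of `R` in degree zero; their coboundaries are given
  -- by the matrices `a`.
  let e (s : ℕ) (l : ι s) :
      Cochain ((singleFunctor (ModuleCat.{u} R) 0).obj (ModuleCat.of R R)) G (c + s) :=
    Cochain.fromSingleMk (q := c + s)
      (ModuleCat.ofHom (LinearMap.toSpanSingleton R _ (b s l))) (zero_add _)
  have he (s : ℕ) (l : ι s) : δ (c + s) (c + (s + 1 : ℕ)) (e s l) =
      ∑ l', a s l l' • e (s + 1) l' := by
    rw [Cochain.δ_fromSingleMk _ _ _ _ (zero_add _), ← Cochain.fromSingleMk_sum_smul]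
    congr 1
    ext
    simp [ModuleCat.hom_sum]
    exact had s l
  let y (s : ℕ) (l : ι s) : Cochain (residueResolution R).cochainComplex G (i + s) :=
    z.1.comp (e s l) (by lia)
  have hy (s : ℕ) (l : ι s) : δ (i + s) (i + (s + 1 : ℕ)) (y s l) =
      ∑ l', a s l l' • y (s + 1) l' := by
    dsimp only [y]
    rw [δ_comp _ _ _ (j + 1) (c + (s + 1 : ℕ)) _ (by lia) rfl (by lia), z.δ_eq_zero, he,
      Cochain.zero_comp, smul_zero, add_zero, Cochain.comp_sum]
    simp only [Cochain.comp_smul]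
  have hδφ₀ (l : ι 0) : δ (-((0 : ℕ) : ℤ)) 1 (φ 0 l) = 0 := by
    have : φ 0 l = if l = l₀ then (Cochain.ofHom (𝟙 _) : Cochain _ _ 0) else 0 := by
      refine Cochain.ext₀ _ _ fun p => ?_
      refine (hφ₀ l p).trans ?_
      split_ifs
      · simp
      · rfl
    rw [this]
    split_ifs
    · exact δ_ofHom _
    · exact δ_zero _ _
  refine ⟨Cocycle.mk _ (i + 1) rfl (δ_sum_higher_homotopies_comp a φ y hδφ₀ hφ hy N),
    fun p h => ?_⟩
  change Cochain.v (∑ s ∈ Finset.range N, ∑ l, (φ s l).comp (y s l) _) p _ _ = _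
  have hv (s : ℕ) (l : ι s) :
      ((φ s l).comp (y s l) (show _ = i by lia)).v p (c + (0 : ℕ)) (by lia) =
        (φ s l).v p (p - s) (by lia) ≫ z.1.v (p - s) (-s) (by lia) ≫
          (e s l).v (-s) (c + (0 : ℕ)) (by lia) := by
    rw [Cochain.comp_v _ _ _ p (p - s) (c + (0 : ℕ)) (by lia) (by lia)]
    dsimp only [y]
    rw [Cochain.comp_v _ _ _ (p - s) (-s) (c + (0 : ℕ)) (by lia) (by lia)]
  have hN : 0 ∈ Finset.range N := by
    rw [Finset.mem_range, Nat.pos_iff_ne_zero]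
    rintro rfl
    exact isEmptyElim l₀
  -- In target degree `c` only `s = 0` survives, because `e s l` is nonzero only from degree `0` to
  -- degree `c + s`. There only `l = l₀` survives, by the initial value of `φ`.
  rw [Cochain.sum_v, Finset.sum_eq_single_of_mem 0 hN, Cochain.sum_v,
    Finset.sum_eq_single_of_mem l₀ (Finset.mem_univ _)]
  · have h0 : p - ((0 : ℕ) : ℤ) = p := by simp
    rw [Cochain.comp_v _ _ _ p p (c + (0 : ℕ)) (by simp) (by lia), hφ₀, if_pos rfl]
    refine (Category.id_comp _).trans ?_
    dsimp only [y]
    rw [Cochain.comp_v _ _ _ p 0 (c + (0 : ℕ)) h (by lia)]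
    congr 1
    exact Cochain.fromSingleMk_v _ _
  · intro l _ hl
    rw [Cochain.comp_v _ _ _ p p (c + (0 : ℕ)) (by simp) (by lia), hφ₀, if_neg hl]
    exact Limits.zero_comp
  · intro s _ hs
    rw [Cochain.sum_v]
    refine Finset.sum_eq_zero fun l _ => ?_
    rw [hv, Cochain.fromSingleMk_v_eq_zero _ _ _ _ _ (by lia), Limits.comp_zero, Limits.comp_zero]

end LocalRing
end

/-! ### Minimal complexes: surjectivity on `Ext`, and the effect of `U(M) = 0` -/

noncomputable section

namespace LocalRing

open StableCohomology CochainComplex HomComplex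

variable {R : Type u} [CommRing R] [IsLocalRing R]

local notation "𝔪" => IsLocalRing.maximalIdeal R
local notation "𝓀" => IsLocalRing.ResidueField R

/-- A complex of finitely generated free modules with `d(G) ⊆ 𝔪 G`. -/
structure IsMinimalFree (G : CochainComplex (ModuleCat.{u} R) ℤ) : Prop where
  free : ∀ i, Module.Free R (G.X i)
  finite : ∀ i, Module.Finite R (G.X i)
  minimal : ∀ (i j : ℤ) (x : G.X i), (G.d i j).hom x ∈ (𝔪 • ⊤ : Submodule R (G.X j))

section

variable [HasDerivedCategory.{w} (ModuleCat.{u} R)]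
  {G : CochainComplex (ModuleCat.{u} R) ℤ}

/-- A cocycle into the free module in degree `c` is the sum of its coordinates, each of which lifts
by `exists_cocycle_lift_of_basis`. -/
lemma exists_cocycle_postcomp_eq (hG : IsMinimalFree G) (c : ℤ) (N : ℕ)
    (hN : Subsingleton (G.X (c + N))) {V : ModuleCat.{u} R}
    (π : G ⟶ (singleFunctor (ModuleCat.{u} R) c).obj V) [IsIso (π.f c)] {i : ℤ}
    (w : Cocycle (residueResolution R).cochainComplex
      ((singleFunctor (ModuleCat.{u} R) c).obj V) i) :
    ∃ w' : Cocycle (residueResolution R).cochainComplex G i, w'.postcomp π = w := by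
  -- The bases are indexed by degrees `c + s`, so degree `c` is written `c + 0` to match `s = 0`.
  obtain ⟨c', hc'⟩ : ∃ c' : ℤ, c' = c + (0 : ℕ) := ⟨_, rfl⟩
  obtain rfl : c' = c := by simpa using hc'
  have := hG.free
  have := hG.finite
  let b (s : ℕ) := Module.Free.chooseBasis R (G.X (c' + s))
  have : IsEmpty (Module.Free.ChooseBasisIndex R (G.X (c' + N))) :=
    ⟨fun l => (b N).ne_zero l (Subsingleton.elim _ _)⟩
  have : IsIso (π.f (c' + (0 : ℕ))) := by rwa [← hc']
  -- The only source degree in which `w` can be nonzero.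
  let p : ℤ := c' - i
  let f : (residueResolution R).cochainComplex.X p ⟶ G.X (c' + (0 : ℕ)) :=
    w.1.v p (c' + (0 : ℕ)) (by lia) ≫ inv (π.f (c' + (0 : ℕ)))
  have hf : (residueResolution R).cochainComplex.d (p - 1) p ≫ f = 0 := by
    have h := Cochain.congr_v (w.δ_eq_zero (i + 1)) (p - 1) c' (by lia)
    rw [δ_v i (i + 1) rfl _ _ _ _ (c' - 1) p rfl (by lia)] at h
    rw [show ((singleFunctor (ModuleCat.{u} R) c').obj V).d (c' - 1) c' = 0 from rfl] at h
    rw [Limits.comp_zero, zero_add, Cochain.zero_v, smul_eq_zero_iff_eq] at h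
    have h' (q : ℤ) (hq : q = c') : (residueResolution R).cochainComplex.d (p - 1) p ≫
        w.1.v p q (by lia) = 0 := by
      subst hq
      exact h
    rw [reassoc_of% (h' _ hc'.symm), Limits.zero_comp]
  let z (l) : Cocycle (residueResolution R).cochainComplex
      ((singleFunctor (ModuleCat.{u} R) 0).obj (ModuleCat.of R R)) (-p) :=
    Cocycle.toSingleMk (q := 0) (f ≫ ModuleCat.ofHom ((b 0).coord l)) (by lia) (p - 1) (by lia)
      (by rw [reassoc_of% hf, Limits.zero_comp])
  choose W hW using fun l => exists_cocycle_lift_of_basis G c' N b (hG.minimal _ _)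
    (show -p + c' = i by lia) (z l) l
  refine ⟨∑ l, W l, ?_⟩
  ext p' q hpq : 2
  by_cases hq : q = c' + (0 : ℕ)
  · obtain rfl : p' = p := by lia
    subst hq
    rw [Cocycle.postcomp_coe, Cochain.comp_zero_cochain_v, Cochain.ofHom_v,
      ← IsIso.eq_comp_inv]
    change _ = f
    have : (∑ l, W l).1 = ∑ l, (W l).1 := map_sum (Cocycle.toCochainAddMonoidHom _ _ i) _ _
    rw [this, Cochain.sum_v]
    ext x
    have h (l) : (W l).1.v p (c' + (0 : ℕ)) hpq =
        f ≫ ModuleCat.ofHom ((b 0).coord l) ≫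
          ModuleCat.ofHom (LinearMap.toSpanSingleton R _ (b 0 l)) := by
      rw [hW l p (by lia)]
      simp only [z, Cocycle.toSingleMk_coe]
      rw [Cochain.toSingleMk_v]
      refine (Category.assoc _ _ _).trans ((Category.assoc _ _ _).trans (congrArg (f ≫ ·) ?_))
      exact congrArg (ModuleCat.ofHom ((b 0).coord l) ≫ ·) (Iso.inv_hom_id_assoc _ _)
    simp only [h]
    simp [ModuleCat.hom_sum]
  · exact (HomologicalComplex.isZero_single_obj_X _ _ _ _ (by lia)).eq_of_tgt _ _

lemma surjective_postcomp_of_isMinimalFree (hG : IsMinimalFree G) (c : ℤ) (N : ℕ)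
    (hN : Subsingleton (G.X (c + N))) {V : ModuleCat.{u} R}
    (π : G ⟶ (singleFunctor (ModuleCat.{u} R) c).obj V) [IsIso (π.f c)] (i : ℤ) :
    Function.Surjective (E.postcomp (i := i) ((DerivedCategory.Q.map π)⟦i⟧')) := by
  intro α
  obtain ⟨x, rfl⟩ := (cohomologyClassEquiv (residueResolutionIso R) (Iso.refl _) i).surjective α
  obtain ⟨w, rfl⟩ := x.mk_surjective
  obtain ⟨w', rfl⟩ := exists_cocycle_postcomp_eq hG c N hN π w
  refine ⟨cohomologyClassEquiv (residueResolutionIso R) (Iso.refl _) i (.mk w'), ?_⟩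
  rw [cohomologyClassEquiv_postcomp _ (Iso.refl _)]
  simp [E.postcomp_apply]

/-- Classes coming from a complex that is bounded in low cohomological degrees are unstable. -/
lemma postcomp_eq_zero_of_U_eq_bot {M : DerivedCategory (ModuleCat.{u} R)}
    (F : MinimalFreeResolution M) (hU : ∀ i, F.U i = ⊥) (c : ℤ)
    (hG : ∀ q < c, Limits.IsZero (G.X q)) (j : G ⟶ F.complex) (i : ℤ) :
    E.postcomp (i := i) ((DerivedCategory.Q.map j ≫ F.iso.hom)⟦i⟧') = 0 := by
  refine LinearMap.ext fun α => ?_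
  obtain ⟨x, rfl⟩ := (cohomologyClassEquiv (residueResolutionIso R) (Iso.refl _) i).surjective α
  obtain ⟨z, rfl⟩ := x.mk_surjective
  have h := cohomologyClassEquiv_postcomp (residueResolutionIso R)
    (Iso.refl (DerivedCategory.Q.obj G)) F.iso i z j
  simp only [Iso.refl_inv, Category.id_comp] at h
  rw [E.postcomp_apply, ← h, LinearMap.zero_apply, ← AddSubgroup.mem_bot, ← hU i]
  change F.iota i _ = 0
  change toStable _ _ _ ((cohomologyClassEquiv _ _ _).symm _) = 0
  rw [AddEquiv.symm_apply_apply]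
  refine (QuotientAddGroup.eq_zero_iff _).2 ?_
  have : stableCocycle (residueResolution R).cochainComplex F.complex i (z.postcomp j) = 0 := by
    -- For `p < c - i` a component of degree `i` lands in `G.X (p + i)` with `p + i < c`, which is
    -- zero.
    refine Subtype.ext ((QuotientAddGroup.eq_zero_iff _).2 ⟨c - i, fun p q hpq hp => ?_⟩)
    have hz : z.1.v p q hpq = 0 := (hG q (by lia)).eq_of_tgt _ _
    change (z.postcomp j).1.v p q hpq = 0
    rw [Cocycle.postcomp_coe, Cochain.comp_zero_cochain_v, hz, Limits.zero_comp]
  rw [this]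
  exact zero_mem _

end

end LocalRing
end

/-! ### Bass numbers of bounded minimal complexes -/

noncomputable section

lemma Function.Exact.finite_of_finite {K V₁ V₂ V₃ : Type*} [Ring K] [IsNoetherianRing K]
    [AddCommGroup V₁] [Module K V₁] [AddCommGroup V₂] [Module K V₂] [AddCommGroup V₃] [Module K V₃]
    {f : V₁ →ₗ[K] V₂} {g : V₂ →ₗ[K] V₃} (h : Function.Exact f g) [Module.Finite K V₁]
    [Module.Finite K V₃] : Module.Finite K V₂ := by
  have : IsNoetherian K V₂ := isNoetherian_of_range_eq_ker f g h.linearMap_ker_eq.symm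
  infer_instance

lemma Function.Exact.finrank_eq {K V₁ V₂ V₃ : Type*} [DivisionRing K]
    [AddCommGroup V₁] [Module K V₁] [AddCommGroup V₂] [Module K V₂] [AddCommGroup V₃] [Module K V₃]
    {f : V₁ →ₗ[K] V₂} {g : V₂ →ₗ[K] V₃} (h : Function.Exact f g) (hf : Function.Injective f)
    (hg : Function.Surjective g) [Module.Finite K V₁] [Module.Finite K V₃] :
    Module.finrank K V₂ = Module.finrank K V₁ + Module.finrank K V₃ := by
  have := h.finite_of_finite
  rw [← g.finrank_range_add_finrank_ker, h.linearMap_ker_eq, LinearMap.finrank_range_of_inj hf,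
    LinearMap.range_eq_top.2 hg, finrank_top, add_comm]

namespace LocalRing

open StableCohomology CochainComplex HomComplex

variable {R : Type u} [CommRing R]

section Truncation

variable {G L : CochainComplex (ModuleCat.{u} R) ℤ}

/-- A morphism of complexes which in each degree is either an isomorphism or has zero target. -/
structure IsDegreewiseTruncation (π : G ⟶ L) : Prop where
  isIso_or_isZero : ∀ i, IsIso (π.f i) ∨ Limits.IsZero (L.X i)

variable {π : G ⟶ L}

/-- The short complex `ker π ⟶ G ⟶ L`. -/
abbrev kernelShortComplex (π : G ⟶ L) : ShortComplex (CochainComplex (ModuleCat.{u} R) ℤ) :=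
  ShortComplex.mk (Limits.kernel.ι π) π (Limits.kernel.condition π)

namespace IsDegreewiseTruncation

lemma shortExact (h : IsDegreewiseTruncation π) : (kernelShortComplex π).ShortExact := by
  have : Epi π := HomologicalComplex.epi_of_epi_f _ fun i => by
    rcases h.isIso_or_isZero i with hi | hi
    · infer_instance
    · exact ⟨fun _ _ _ => hi.eq_of_src _ _⟩
  exact { exact := ShortComplex.exact_kernel π }

lemma shortExact_eval (h : IsDegreewiseTruncation π) (i : ℤ) :
    ((kernelShortComplex π).map (HomologicalComplex.eval _ _ i)).ShortExact :=
  (HomologicalComplex.shortExact_iff_degreewise_shortExact _).1 h.shortExact i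

lemma isIso_ι_f (h : IsDegreewiseTruncation π) {i : ℤ} (hi : Limits.IsZero (L.X i)) :
    IsIso ((Limits.kernel.ι π).f i) :=
  (h.shortExact_eval i).isIso_f_iff.2 hi

lemma isZero_kernel_X (h : IsDegreewiseTruncation π) {i : ℤ} (hi : IsIso (π.f i)) :
    Limits.IsZero ((Limits.kernel π).X i) :=
  (h.shortExact_eval i).isIso_g_iff.1 hi

lemma finrank_kernel_X (h : IsDegreewiseTruncation π) {i : ℤ} (hi : Limits.IsZero (L.X i)) :
    Module.finrank R ((Limits.kernel π).X i) = Module.finrank R (G.X i) := by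
  have := h.isIso_ι_f hi
  exact (asIso ((Limits.kernel.ι π).f i)).toLinearEquiv.finrank_eq

end IsDegreewiseTruncation

/-- No nonzero differential enters `G.X c`, so the identity in degree `c` is a chain map onto the
single complex. -/
lemma exists_truncation_to_single (G : CochainComplex (ModuleCat.{u} R) ℤ) (c : ℤ)
    (hc : Subsingleton (G.X (c - 1))) :
    ∃ π : G ⟶ (singleFunctor (ModuleCat.{u} R) c).obj (G.X c),
      IsIso (π.f c) ∧ IsDegreewiseTruncation π := by
  have h : ∀ i, (ComplexShape.up ℤ).Rel i c → G.d i c ≫ 𝟙 (G.X c) = 0 := by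
    intro i hi
    obtain rfl : i = c - 1 := eq_sub_of_add_eq hi
    exact (ModuleCat.isZero_of_subsingleton _).eq_of_src _ _
  have hiso : IsIso ((HomologicalComplex.mkHomToSingle (𝟙 (G.X c)) h).f c) := by
    rw [HomologicalComplex.mkHomToSingle_f]
    infer_instance
  refine ⟨HomologicalComplex.mkHomToSingle (𝟙 (G.X c)) h, hiso, ⟨fun i => ?_⟩⟩
  by_cases hi : i = c
  · subst hi
    exact .inl hiso
  · exact .inr (HomologicalComplex.isZero_single_obj_X _ _ _ _ hi)

variable [IsLocalRing R]

local notation "𝔪" => IsLocalRing.maximalIdeal R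
local notation "𝓀" => IsLocalRing.ResidueField R

/-- In each degree the kernel is either zero or all of `G`. -/
lemma IsDegreewiseTruncation.isMinimalFree_kernel (h : IsDegreewiseTruncation π) (hG : IsMinimalFree G) :
    IsMinimalFree (Limits.kernel π) := by
  have hcases (i : ℤ) : IsIso ((Limits.kernel.ι π).f i) ∨ Subsingleton ((Limits.kernel π).X i) := by
    rcases h.isIso_or_isZero i with hi | hi
    · exact .inr (ModuleCat.isZero_iff_subsingleton.1 (h.isZero_kernel_X hi))
    · exact .inl (h.isIso_ι_f hi)
  refine ⟨fun i => ?_, fun i => ?_, fun i j x => ?_⟩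
  · rcases hcases i with hi | hi
    · have := hG.free i
      exact Module.Free.of_equiv (asIso ((Limits.kernel.ι π).f i)).toLinearEquiv.symm
    · infer_instance
  · rcases hcases i with hi | hi
    · have := hG.finite i
      exact Module.Finite.equiv (asIso ((Limits.kernel.ι π).f i)).toLinearEquiv.symm
    · infer_instance
  · rcases hcases j with hj | hj
    · let e := (asIso ((Limits.kernel.ι π).f j)).toLinearEquiv
      have h1 : e (((Limits.kernel π).d i j).hom x) =
          (G.d i j).hom (((Limits.kernel.ι π).f i).hom x) :=
        LinearMap.congr_fun (congrArg ModuleCat.Hom.hom ((Limits.kernel.ι π).comm i j)).symm x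
      have h2 : e (((Limits.kernel π).d i j).hom x) ∈ (𝔪 • ⊤ : Submodule R (G.X j)) := by
        rw [h1]
        exact hG.minimal _ _ _
      rw [← e.symm_apply_apply (((Limits.kernel π).d i j).hom x)]
      have h3 := Submodule.mem_map_of_mem (f := e.symm.toLinearMap) h2
      rw [Submodule.map_smul''] at h3
      exact Submodule.smul_mono le_rfl le_top h3
    · rw [Subsingleton.elim (((Limits.kernel π).d i j).hom x) 0]
      exact zero_mem _

end Truncation

variable [IsLocalRing R]

local notation "𝔪" => IsLocalRing.maximalIdeal R
local notation "𝓀" => IsLocalRing.ResidueField R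

variable [HasDerivedCategory.{w} (ModuleCat.{u} R)]

lemma finite_E_single_and_finrank (hR : HasBassSeries (ringComplex R)) (V : ModuleCat.{u} R)
    [Module.Free R V] [Module.Finite R V] (c i : ℤ) :
    Module.Finite 𝓀 (E ((DerivedCategory.singleFunctor (ModuleCat.{u} R) c).obj V) i) ∧
    Module.finrank 𝓀 (E ((DerivedCategory.singleFunctor (ModuleCat.{u} R) c).obj V) i) =
      Module.finrank R V * bassNumber (ringComplex R) (i - c) := by
  let b := Module.Free.chooseBasis R V
  let e := (E.freeEquiv b c i).trans (LinearEquiv.piCongrRight fun _ =>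
    E.singleShift (ModuleCat.of R R) c 0 i (i - c) (by lia))
  have := hR.1 (i - c)
  refine ⟨Module.Finite.equiv e.symm, ?_⟩
  rw [e.finrank_eq, Module.finrank_pi_fintype, Module.finrank_eq_card_basis b]
  simp [bassNumber]

/-- The Bass numbers of a bounded minimal complex of free modules. -/
theorem finite_E_and_finrank_of_bounded (hR : HasBassSeries (ringComplex R)) (s : ℕ)
    (G : CochainComplex (ModuleCat.{u} R) ℤ) (hG : IsMinimalFree G) (c : ℤ)
    (h₁ : ∀ q < c, Subsingleton (G.X q)) (h₂ : ∀ q, c + s ≤ q → Subsingleton (G.X q)) (i : ℤ) :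
    Module.Finite 𝓀 (E (DerivedCategory.Q.obj G) i) ∧
    bassNumber (DerivedCategory.Q.obj G) i =
      ∑ q ∈ Finset.Ico c (c + s), Module.finrank R (G.X q) * bassNumber (ringComplex R) (i - q) := by
  induction s generalizing G c i with
  | zero =>
    have hz : Limits.IsZero G := by
      rw [Limits.IsZero.iff_id_eq_zero]
      ext q : 1
      have : Subsingleton (G.X q) := by
        rcases lt_or_ge q c with h | h
        · exact h₁ q h
        · exact h₂ q (by simpa using h)
      exact (ModuleCat.isZero_of_subsingleton _).eq_of_src _ _
    have hz' : Limits.IsZero ((DerivedCategory.Q.obj G)⟦i⟧) :=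
      Functor.map_isZero _ (Functor.map_isZero _ hz)
    have : Subsingleton (E (DerivedCategory.Q.obj G) i) := ⟨fun x y => hz'.eq_of_tgt _ _⟩
    refine ⟨inferInstance, ?_⟩
    simp [bassNumber, Module.finrank_zero_of_subsingleton]
  | succ s ih =>
    -- Split off the lowest component; the kernel lives in `s` degrees starting at `c + 1`.
    obtain ⟨π, hπc, hπ⟩ := exists_truncation_to_single G c (h₁ _ (by lia))
    have hz (q : ℤ) (hq : q ≠ c) :
        Limits.IsZero (((singleFunctor (ModuleCat.{u} R) c).obj (G.X c)).X q) :=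
      HomologicalComplex.isZero_single_obj_X _ _ _ _ hq
    have hsub (q : ℤ) (hq : Subsingleton (G.X q)) : Subsingleton ((Limits.kernel π).X q) := by
      by_cases h : q = c
      · subst h
        exact ModuleCat.isZero_iff_subsingleton.1 (hπ.isZero_kernel_X hπc)
      · have := hπ.isIso_ι_f (hz q h)
        exact (asIso ((Limits.kernel.ι π).f q)).toLinearEquiv.toEquiv.subsingleton
    obtain hK := fun i => ih (Limits.kernel π) (hπ.isMinimalFree_kernel hG) (c + 1)
      (fun q hq => by
        by_cases h : q = c
        · subst h
          exact ModuleCat.isZero_iff_subsingleton.1 (hπ.isZero_kernel_X hπc)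
        · exact hsub q (h₁ q (by lia)))
      (fun q hq => hsub q (h₂ q (by push_cast; lia))) i
    have := hG.free
    have := hG.finite
    obtain hS := fun i => finite_E_single_and_finrank hR (G.X c) c i
    have hT := DerivedCategory.triangleOfSES_distinguished hπ.shortExact
    have hsurj (i : ℤ) : Function.Surjective
        (E.postcomp (i := i) ((DerivedCategory.triangleOfSES hπ.shortExact).mor₂⟦i⟧')) :=
      surjective_postcomp_of_isMinimalFree hG c (s + 1) (h₂ _ (by push_cast; lia)) π i
    -- The kernel is the image of the connecting map from degree `i - 1`, which vanishes because
    -- `mor₂` is surjective on `Ext` there.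
    have hinj : Function.Injective
        (E.postcomp (i := i) ((DerivedCategory.triangleOfSES hπ.shortExact).mor₁⟦i⟧')) := by
      rw [injective_iff_map_eq_zero]
      intro x hx
      obtain ⟨y, rfl⟩ := (E.exact₁ hT (i - 1) i (by lia) x).1 hx
      obtain ⟨y, rfl⟩ := hsurj _ y
      exact (E.exact₃ hT (i - 1) i (by lia)).apply_apply_eq_zero y
    have hex := E.exact₂ hT i
    have : Module.Finite 𝓀 (E (DerivedCategory.triangleOfSES hπ.shortExact).obj₁ i) := (hK i).1
    have : Module.Finite 𝓀 (E (DerivedCategory.triangleOfSES hπ.shortExact).obj₃ i) := (hS i).1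
    refine ⟨hex.finite_of_finite, (hex.finrank_eq hinj (hsurj i)).trans ?_⟩
    refine (congrArg₂ (· + ·) (hK i).2 (hS i).2).trans ?_
    rw [show c + ((s + 1 : ℕ) : ℤ) = c + 1 + s by push_cast; ring,
      ← Finset.insert_Ico_add_one_left_eq_Ico (show c < c + 1 + s by lia),
      Finset.sum_insert (by simp), add_comm]
    congr 1
    refine Finset.sum_congr rfl fun q hq => ?_
    rw [hπ.finrank_kernel_X (hz q (by rw [Finset.mem_Ico] at hq; lia))]

end LocalRing
end

/-! ### Finiteness of `Ext(k, C)` for a finitely generated module -/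

noncomputable section

namespace LocalRing

variable {R : Type u} [CommRing R] [IsNoetherianRing R]

open Abelian in
/-- Over a noetherian ring, the modules `Ext^n(N, C)` of finitely generated modules are finitely
generated. -/
lemma finite_ext (C : ModuleCat.{u} R) [Module.Finite R C] (n : ℕ) (N : ModuleCat.{u} R)
    [Module.Finite R N] : Module.Finite R (Ext.{u} N C n) := by
  induction n generalizing N with
  | zero =>
    have : Module.Finite R (N →ₗ[R] C) := inferInstance
    exact Module.Finite.equiv
      ((Ext.linearEquiv₀ (R := R)).trans (ModuleCat.homLinearEquiv (S := R))).symm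
  | succ n ih =>
    obtain ⟨m, f, hf⟩ := Module.Finite.exists_fin' R N
    let S : ShortComplex (ModuleCat.{u} R) :=
      ShortComplex.mk (ModuleCat.ofHom (LinearMap.ker f).subtype)
        (ModuleCat.ofHom (Y := N) f) (by ext x; exact x.2)
    have hS : S.ShortExact :=
      { exact := by
          rw [ShortComplex.ShortExact.moduleCat_exact_iff_function_exact]
          exact LinearMap.exact_subtype_ker_map f
        mono_f := (ModuleCat.mono_iff_injective _).2 Subtype.val_injective
        epi_g := (ModuleCat.epi_iff_surjective _).2 hf }
    have : Module.Finite R S.X₁ := inferInstanceAs (Module.Finite R (LinearMap.ker f))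
    have : Projective S.X₂ := ModuleCat.projective_of_free (Pi.basisFun R (Fin m))
    have := ih S.X₁
    -- Dimension shifting along `0 → ker f → R^m → N → 0`: the connecting map onto `Ext^{n+1}(N, C)`
    -- is surjective since `R^m` is projective.
    refine Module.Finite.of_surjective
      (Ext.precompOfLinear hS.extClass R C (show 1 + n = n + 1 by lia)) fun x => ?_
    exact Ext.contravariant_sequence_exact₃ hS C x (Ext.eq_zero_of_projective _) (by lia)

variable [IsLocalRing R] [HasDerivedCategory.{w} (ModuleCat.{u} R)]

/-- After shifting to degree zero, `Ext^n(k, C)` is finitely generated over `R`, and `R` acts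
through `k`. -/
lemma hasBassSeries_single (C : ModuleCat.{u} R) [Module.Finite R C] (c : ℤ) :
    HasBassSeries ((DerivedCategory.singleFunctor (ModuleCat.{u} R) c).obj C) := by
  have hneg (i : ℤ) (hi : i < c) :
      Subsingleton (E ((DerivedCategory.singleFunctor (ModuleCat.{u} R) c).obj C) i) :=
    subsingleton_E_of_isGE _ c i hi
  refine ⟨fun i => ?_, c, hneg⟩
  rcases lt_or_ge i c with hi | hi
  · have := hneg i hi
    infer_instance
  · obtain ⟨n, hn⟩ := Int.le.dest hi
    have : Module.Finite (IsLocalRing.ResidueField R)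
        (E ((DerivedCategory.singleFunctor (ModuleCat.{u} R) 0).obj C) n) := by
      have : Module.Finite R (IsLocalRing.ResidueField R) :=
        Module.Finite.of_surjective (Algebra.linearMap R _) IsLocalRing.residue_surjective
      have := finite_ext C n (residueModule R)
      have : Module.Finite R (E ((DerivedCategory.singleFunctor (ModuleCat.{u} R) 0).obj C) n) :=
        Module.Finite.equiv (Abelian.Ext.homLinearEquiv (R := R))
      have : IsScalarTower R (IsLocalRing.ResidueField R)
          (E ((DerivedCategory.singleFunctor (ModuleCat.{u} R) 0).obj C) n) :=
        (isTorsionBySet_E _ _).isScalarTower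
      exact Module.Finite.of_restrictScalars_finite R _ _
    exact Module.Finite.equiv (E.singleShift C c 0 i n (by lia)).symm

end LocalRing
end

/-! ### Stupid truncations and Betti numbers -/

noncomputable section

namespace LocalRing

variable {R : Type u} [CommRing R]

section StupidTrunc

variable {C : Type*} [Category C] [Limits.HasZeroMorphisms C] [Limits.HasZeroObject C]

/-- The projection of a cochain complex onto its stupid truncation in degrees `≤ p`. -/
def toStupidTrunc (K : CochainComplex C ℤ) (p : ℤ) :
    K ⟶ K.stupidTrunc (ComplexShape.embeddingUpIntLE p) :=
  -- Degrees `≤ p` are closed under predecessors, so the boundary condition for the lift is vacuous.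
  (ComplexShape.embeddingUpIntLE p).liftExtend (𝟙 _) fun j hj i' hi' => by
    obtain ⟨i, rfl⟩ := (ComplexShape.embeddingUpIntLE p).mem_prev hi'
    exact (hj.2 i hi').elim

lemma isIso_toStupidTrunc_f (K : CochainComplex C ℤ) (p q : ℤ) (h : q ≤ p) :
    IsIso ((toStupidTrunc K p).f q) := by
  obtain ⟨n, hn⟩ := Int.le.dest h
  exact (ComplexShape.Embedding.isIso_liftExtend_f_iff (ComplexShape.embeddingUpIntLE p) _ _
    (i := n) (show p - n = q by lia)).2 inferInstance

lemma isZero_stupidTrunc_X (K : CochainComplex C ℤ) (p q : ℤ) (h : p < q) :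
    Limits.IsZero ((K.stupidTrunc (ComplexShape.embeddingUpIntLE p)).X q) :=
  K.isZero_stupidTrunc_X _ q ((ComplexShape.notMem_range_embeddingUpIntLE_iff p q).2 h)

end StupidTrunc

lemma isDegreewiseTruncation_toStupidTrunc (K : CochainComplex (ModuleCat.{u} R) ℤ) (p : ℤ) :
    IsDegreewiseTruncation (toStupidTrunc K p) :=
  ⟨fun q => (le_or_gt q p).imp (isIso_toStupidTrunc_f K p q) (isZero_stupidTrunc_X K p q)⟩

variable [IsLocalRing R]

local notation "𝔪" => IsLocalRing.maximalIdeal R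
local notation "𝓀" => IsLocalRing.ResidueField R

section ResidueTensor

open TensorProduct ModuleCat.ExtendScalars

/-- The `k`-module underlying `residueTensor.obj V` is `k ⊗[R] V`. -/
def residueTensorEquiv (V : ModuleCat.{u} R) : residueTensor.obj V ≃ₗ[𝓀] 𝓀 ⊗[R] V :=
  let e : (ModuleCat.restrictScalars (IsLocalRing.residue R)).obj (ModuleCat.of 𝓀 𝓀) ≃ₗ[R] 𝓀 :=
    { toFun := fun x => x
      invFun := fun x => x
      map_add' := fun _ _ => rfl
      map_smul' := fun r x => (Algebra.smul_def r (show 𝓀 from x)).symm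
      left_inv := fun _ => rfl
      right_inv := fun _ => rfl }
  let T := TensorProduct.congr e (LinearEquiv.refl R V)
  { T.toAddEquiv with
    map_smul' := fun s x => by
      change T (s • x) = s • T x
      induction x using TensorProduct.induction_on with
      | zero =>
        exact (congrArg T (smul_zero (A := residueTensor.obj V) s)).trans ((map_zero T).trans
          ((congrArg (s • ·) (map_zero T)).trans (smul_zero s)).symm)
      | tmul s' v => rfl
      | add x y hx hy =>
        exact (congrArg T (smul_add (A := residueTensor.obj V) s x y)).trans ((map_add T _ _).trans
          ((congrArg₂ (· + ·) hx hy).trans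
            ((congrArg (s • ·) (map_add T x y)).trans (smul_add s _ _)).symm)) }

lemma residueTensor_map_eq_zero {V W : ModuleCat.{u} R} (f : V ⟶ W)
    (hf : ∀ x, f.hom x ∈ (𝔪 • ⊤ : Submodule R W)) : residueTensor.map f = 0 := by
  ext x
  have key (s : 𝓀) (y : W) (hy : y ∈ (𝔪 • ⊤ : Submodule R W)) : s ⊗ₜ[R] y = 0 := by
    induction hy using Submodule.smul_induction_on' with
    | smul r hr v _ =>
      rw [← TensorProduct.smul_tmul, Algebra.smul_def,
        show algebraMap R 𝓀 r = 0 from (IsLocalRing.residue_eq_zero_iff r).2 hr, zero_mul,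
        TensorProduct.zero_tmul]
    | add x _ y _ hx hy => rw [TensorProduct.tmul_add, hx, hy, add_zero]
  apply (residueTensorEquiv W).injective
  exact (key 1 (f.hom x) (hf x)).trans (map_zero _).symm

end ResidueTensor

namespace MinimalFreeResolution

variable [HasDerivedCategory.{w} (ModuleCat.{u} R)] {M : DerivedCategory (ModuleCat.{u} R)}
  (F : MinimalFreeResolution M)

/-- `Tor_i(k, M) = k ⊗ F_i` for a minimal free resolution `F`. -/
def torEquiv (i : ℤ) : F.tor i ≃ₗ[𝓀] TensorProduct R 𝓀 (F.complex.X (-i)) :=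
  let K := (residueTensor.mapHomologicalComplex (.up ℤ)).obj F.complex
  -- Minimality makes the differential of `k ⊗ F` zero, so homology is the complex itself.
  have hd (p q : ℤ) : K.d p q = 0 := residueTensor_map_eq_zero _ (F.minimal p q)
  (ShortComplex.LeftHomologyData.ofZeros (K.sc (-i)) (hd _ _)
    (hd _ _)).homologyIso.toLinearEquiv.trans (residueTensorEquiv _)

lemma bettiNumber_eq (i : ℤ) : F.bettiNumber i = Module.finrank R (F.complex.X (-i)) := by
  have := F.free (-i)
  rw [bettiNumber, (F.torEquiv i).finrank_eq, Module.finrank_baseChange]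

lemma hasPoincareSeries : F.HasPoincareSeries := by
  refine ⟨fun i => ?_, ?_⟩
  · have := F.finite (-i)
    exact Module.Finite.equiv (F.torEquiv i).symm
  · obtain ⟨a, ha⟩ := F.bounded
    refine ⟨a, fun i hi => ?_⟩
    have := ha i hi
    exact (F.torEquiv i).toEquiv.subsingleton

lemma isMinimalFree : IsMinimalFree F.complex := ⟨F.free, F.finite, F.minimal⟩

end MinimalFreeResolution

end LocalRing
end

/-! ### Syzygies: finiteness and splitting of the long exact sequence -/

noncomputable section

namespace LocalRing

open DerivedCategory

section Laurent

lemma coeff_laurent {a : ℤ → ℕ} {b : ℤ} (hb : ∀ i < b, a i = 0) (i : ℤ) :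
    (laurent a).coeff i = a i := by
  have h : BddBelow (Function.support fun i => (a i : ℤ)) :=
    ⟨b, fun i hi => le_of_not_gt fun hlt => hi (by simp [hb i hlt])⟩
  rw [laurent, dif_pos h]
  rfl

lemma coeff_tPow_mul_truncInv_mul (n m : ℤ) (p q : LaurentSeries ℤ) (i : ℤ) :
    (tPow n * truncInv p m * q).coeff i =
      ∑ j ∈ Finset.Icc p.order m, p.coeff j * q.coeff (i - n + j) := by
  rw [mul_assoc, HahnSeries.coeff_single_mul, one_mul, truncInv, Finset.sum_mul,
    HahnSeries.coeff_sum]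
  refine Finset.sum_congr rfl fun j _ => ?_
  rw [HahnSeries.coeff_single_mul, sub_neg_eq_add]

end Laurent

variable {R : Type u} [CommRing R] [HasDerivedCategory.{w} (ModuleCat.{u} R)]

lemma IsDfb.exists_isGE {M : DerivedCategory (ModuleCat.{u} R)} (hM : IsDfb M) : ∃ a : ℤ, M.IsGE a := by
  obtain ⟨a, b, h⟩ := hM.2
  refine ⟨-b, (isGE_iff M (-b)).2 fun i hi => ?_⟩
  have := h (-i) (.inr (by lia))
  rw [homology, neg_neg] at this
  exact ModuleCat.isZero_iff_subsingleton.2 this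

variable [IsLocalRing R]

local notation "𝓀" => IsLocalRing.ResidueField R

lemma HasBassSeries.coeff_bassSeries {M : DerivedCategory (ModuleCat.{u} R)}
    (hM : HasBassSeries M) (i : ℤ) : (bassSeries M).coeff i = bassNumber M i := by
  obtain ⟨a, ha⟩ := hM.2
  refine coeff_laurent (b := a) (fun i hi => ?_) i
  have := ha i hi
  exact Module.finrank_zero_of_subsingleton

namespace MinimalFreeResolution

variable {M : DerivedCategory (ModuleCat.{u} R)} (F : MinimalFreeResolution M)

lemma coeff_poincareSeries (i : ℤ) : F.poincareSeries.coeff i = F.bettiNumber i := by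
  obtain ⟨a, ha⟩ := F.hasPoincareSeries.2
  refine coeff_laurent (b := a) (fun i hi => ?_) i
  have := ha i hi
  exact Module.finrank_zero_of_subsingleton

lemma bettiNumber_eq_zero_of_lt_order {i : ℤ} (hi : i < F.poincareSeries.order) :
    F.bettiNumber i = 0 := by
  have := HahnSeries.coeff_eq_zero_of_lt_order hi
  rwa [F.coeff_poincareSeries, Nat.cast_eq_zero] at this

/-- A free module of rank `β = 0` vanishes. This bounds `F_{<n}` by the same index at which the sum
in `truncInv` starts. -/
lemma subsingleton_X_of_lt_order {q : ℤ} (hq : -q < F.poincareSeries.order) :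
    Subsingleton (F.complex.X q) := by
  have := F.free q
  have := F.finite q
  have h := F.bettiNumber_eq_zero_of_lt_order hq
  rw [F.bettiNumber_eq, neg_neg, Module.finrank_eq_card_chooseBasisIndex,
    Fintype.card_eq_zero_iff] at h
  exact (Module.Free.chooseBasis R (F.complex.X q)).repr.toEquiv.subsingleton

/-- The quotient complex `F_{≥ n}`. -/
abbrev upper (n : ℤ) : CochainComplex (ModuleCat.{u} R) ℤ :=
  F.complex.stupidTrunc (ComplexShape.embeddingUpIntLE (-n))

/-- The subcomplex `F_{< n}`. -/
abbrev lower (n : ℤ) : CochainComplex (ModuleCat.{u} R) ℤ :=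
  Limits.kernel (toStupidTrunc F.complex (-n))

lemma isDegreewiseTruncation (n : ℤ) : IsDegreewiseTruncation (toStupidTrunc F.complex (-n)) :=
  isDegreewiseTruncation_toStupidTrunc _ _

/-- The distinguished triangle `F_{< n} ⟶ F ⟶ F_{≥ n} ⟶`. -/
abbrev triangle (n : ℤ) : Pretriangulated.Triangle (DerivedCategory (ModuleCat.{u} R)) :=
  triangleOfSES (F.isDegreewiseTruncation n).shortExact

lemma triangle_distinguished (n : ℤ) : F.triangle n ∈ Pretriangulated.distinguishedTriangles :=
  triangleOfSES_distinguished _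

lemma isZero_lower_X (n : ℤ) {q : ℤ} (hq : q ≤ -n) : Limits.IsZero ((F.lower n).X q) :=
  (F.isDegreewiseTruncation n).isZero_kernel_X (isIso_toStupidTrunc_f _ _ _ hq)

lemma finrank_lower_X (n : ℤ) {q : ℤ} (hq : -n < q) :
    Module.finrank R ((F.lower n).X q) = F.bettiNumber (-q) := by
  rw [(F.isDegreewiseTruncation n).finrank_kernel_X (isZero_stupidTrunc_X _ _ _ hq),
    F.bettiNumber_eq, neg_neg]

lemma finite_E_lower_and_bassNumber (hR : HasBassSeries (ringComplex R)) (n i : ℤ) :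
    Module.Finite 𝓀 (E (Q.obj (F.lower n)) i) ∧
      bassNumber (Q.obj (F.lower n)) i = ∑ j ∈ Finset.Icc F.poincareSeries.order (n - 1),
        F.bettiNumber j * bassNumber (ringComplex R) (i + j) := by
  -- The number of degrees `order ≤ j < n`; it is `0` when `n ≤ order`, where `F_{<n} = 0` and the
  -- sum is empty.
  let s : ℕ := (n - F.poincareSeries.order).toNat
  have h := finite_E_and_finrank_of_bounded hR s (F.lower n)
    ((F.isDegreewiseTruncation n).isMinimalFree_kernel F.isMinimalFree) (-n + 1)
    (fun q hq => ModuleCat.isZero_iff_subsingleton.1 (F.isZero_lower_X n (by lia)))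
    (fun q hq => by
      have := F.subsingleton_X_of_lt_order (q := q) (by lia)
      have := (F.isDegreewiseTruncation n).isIso_ι_f (isZero_stupidTrunc_X F.complex (-n) q (by lia))
      exact (asIso ((Limits.kernel.ι (toStupidTrunc F.complex (-n))).f q)).toLinearEquiv.toEquiv.subsingleton)
    i
  refine ⟨h.1, h.2.trans ?_⟩
  refine Finset.sum_nbij' (fun q => -q) (fun j => -j) ?_ ?_ (by simp) (by simp) ?_
  · intro q hq
    simp only [Finset.mem_Ico, Finset.mem_Icc] at hq ⊢
    lia
  · intro q hq
    simp only [Finset.mem_Ico, Finset.mem_Icc] at hq ⊢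
    lia
  · intro q hq
    rw [Finset.mem_Ico] at hq
    rw [F.finrank_lower_X n (by lia), sub_eq_add_neg]

instance (n : ℤ) : (Q.obj (F.lower n)).IsGE (-n + 1) := by
  have : (F.lower n).IsStrictlyGE (-n + 1) := by
    rw [CochainComplex.isStrictlyGE_iff]
    exact fun q hq => F.isZero_lower_X n (by lia)
  infer_instance

/-- The `Ext` spaces of `Ω^n M` in terms of the truncated complex `F_{≥ n}`. -/
def syzygyEquiv (n i : ℤ) : E (F.syzygy n) i ≃ₗ[𝓀] E (Q.obj (F.upper n)) (i - n) :=
  E.congr ((CategoryTheory.shiftFunctor _ i).mapIso ((Q.commShiftIso (-n)).app (F.upper n)) ≪≫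
    ((CategoryTheory.shiftFunctorAdd' _ (-n) i (i - n) (by lia)).app _).symm)

section Noetherian

variable [IsNoetherianRing R]

lemma finite_homology_upper (n q : ℤ) : Module.Finite R ((F.upper n).homology q) := by
  have h : Module.Finite R ((F.upper n).X q) := by
    rcases le_or_gt q (-n) with hq | hq
    · have := isIso_toStupidTrunc_f F.complex (-n) q hq
      have := F.finite q
      exact Module.Finite.equiv (asIso ((toStupidTrunc F.complex (-n)).f q)).toLinearEquiv
    · have := ModuleCat.isZero_iff_subsingleton.1 (isZero_stupidTrunc_X F.complex (-n) q hq)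
      infer_instance
  have h' : Module.Finite R ((F.upper n).cycles q) :=
    Module.Finite.of_injective ((F.upper n).iCycles q).hom
      ((ModuleCat.mono_iff_injective _).1 inferInstance)
  exact Module.Finite.of_surjective ((F.upper n).homologyπ q).hom
    ((ModuleCat.epi_iff_surjective _).1 inferInstance)

/-- In the rotated triangle `F ⟶ F_{≥n} ⟶ ΣF_{<n}` the outer terms have cohomology in degrees `≥
-n`, while `F_{≥n}` lives in degrees `≤ -n`. Hence `F_{≥n}` is a shifted finitely generated module.
-/
lemma hasBassSeries_upper_of_isGE (n : ℤ) (hM : M.IsGE (-n)) :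
    HasBassSeries (Q.obj (F.upper n)) := by
  have : (Q.obj (F.upper n)).IsLE (-n) := inferInstance
  have h₁ : (Q.obj F.complex).IsGE (-n) := TStructure.t.isGE_of_iso F.iso.symm (-n)
  have h₂ : ((Q.obj (F.lower n))⟦(1 : ℤ)⟧).IsGE (-n) :=
    TStructure.t.isGE_shift (Q.obj (F.lower n)) (-n + 1) 1 (-n) (by lia)
  have : (Q.obj (F.upper n)).IsGE (-n) :=
    TStructure.t.isGE₂ _ (Pretriangulated.rot_of_distTriang _ (F.triangle_distinguished n)) (-n)
      h₁ h₂
  obtain ⟨Y, ⟨e⟩⟩ := exists_iso_singleFunctor_obj_of_isGE_of_isLE (Q.obj (F.upper n)) (-n)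
  have : Module.Finite R ((HomologicalComplex.homologyFunctor (ModuleCat.{u} R)
      (ComplexShape.up ℤ) (-n)).obj (F.upper n)) := F.finite_homology_upper n (-n)
  have : Module.Finite R Y := Module.Finite.equiv
    (((homologyFunctorFactors (ModuleCat.{u} R) (-n)).app (F.upper n)).symm ≪≫
      (homologyFunctor (ModuleCat.{u} R) (-n)).mapIso e ≪≫
      (singleFunctorCompHomologyFunctorIso (ModuleCat.{u} R) (-n)).app Y).toLinearEquiv
  have h := hasBassSeries_single Y (-n)
  let E' (i : ℤ) := E.congr (i := i) (j := i)
    ((CategoryTheory.shiftFunctor (DerivedCategory (ModuleCat.{u} R)) i).mapIso e)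
  refine ⟨fun i => ?_, -n, fun i hi => subsingleton_E_of_isGE _ (-n) i hi⟩
  have := h.1 i
  exact Module.Finite.equiv (E' i).symm

lemma _root_.LocalRing.hasBassSeries_ringComplex : HasBassSeries (ringComplex R) :=
  hasBassSeries_single _ 0

/-- Truncating `F` at the lower cohomological bound `a` of `M` puts `M` in a triangle between a
bounded free complex and a shifted module, both with finite `Ext`. -/
lemma hasBassSeries (F : MinimalFreeResolution M) (hM : IsDfb M) : HasBassSeries M := by
  obtain ⟨a, ha⟩ := hM.exists_isGE
  refine ⟨fun i => ?_, a, fun i hi => subsingleton_E_of_isGE M a i hi⟩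
  have ha' : M.IsGE (-(-a)) := by rwa [neg_neg]
  have : Module.Finite 𝓀 (E (F.triangle (-a)).obj₃ i) :=
    (F.hasBassSeries_upper_of_isGE (-a) ha').1 i
  have : Module.Finite 𝓀 (E (F.triangle (-a)).obj₁ i) :=
    (F.finite_E_lower_and_bassNumber hasBassSeries_ringComplex (-a) i).1
  have : Module.Finite 𝓀 (E (Q.obj F.complex) i) :=
    (E.exact₂ (F.triangle_distinguished (-a)) i).finite_of_finite
  exact Module.Finite.equiv (E.congr (i := i) (j := i)
    ((CategoryTheory.shiftFunctor (DerivedCategory (ModuleCat.{u} R)) i).mapIso F.iso))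

/-- When `U(M) = 0`, the long exact sequence of `F_{< n} ⟶ F ⟶ F_{≥ n}` splits into short exact
sequences. -/
lemma finite_E_syzygy_and_bassNumber (hM : IsDfb M) (hU : ∀ i, F.U i = ⊥) (n i : ℤ) :
    Module.Finite 𝓀 (E (F.syzygy n) i) ∧
      bassNumber (F.syzygy n) i =
        bassNumber M (i - n) + bassNumber (Q.obj (F.lower n)) (i - n + 1) := by
  -- The one use of `U(M) = 0`: `F_{<n}` vanishes in cohomological degrees below `-n + 1`, so its
  -- classes become unstable in `M`; the isomorphism `F ≅ M` is then cancelled.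
  have hzero (i : ℤ) : E.postcomp (i := i) ((F.triangle n).mor₁⟦i⟧') = 0 := by
    have h := postcomp_eq_zero_of_U_eq_bot F hU (-n + 1)
      (fun q hq => F.isZero_lower_X n (by lia)) (Limits.kernel.ι _) i
    refine LinearMap.ext fun α => ?_
    have h' : (show residueComplex R ⟶ (Q.obj (F.lower n))⟦i⟧ from α) ≫
        (Q.map (Limits.kernel.ι (toStupidTrunc F.complex (-n))) ≫ F.iso.hom)⟦i⟧' = 0 :=
      LinearMap.congr_fun h α
    rw [Functor.map_comp, ← Category.assoc] at h'
    exact (cancel_mono (F.iso.hom⟦i⟧')).1 (h'.trans Limits.zero_comp.symm)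
  have hT := F.triangle_distinguished n
  have hinj : Function.Injective (E.postcomp (i := i - n) ((F.triangle n).mor₂⟦i - n⟧')) := by
    rw [injective_iff_map_eq_zero]
    intro x hx
    obtain ⟨y, rfl⟩ := (E.exact₂ hT (i - n) x).1 hx
    rw [hzero, LinearMap.zero_apply]
  have hsurj : Function.Surjective (E.connecting (F.triangle n) (i - n) (i - n + 1) rfl) :=
    fun x => (E.exact₁ hT (i - n) (i - n + 1) rfl x).1 (by rw [hzero, LinearMap.zero_apply])
  have hex := E.exact₃ hT (i - n) (i - n + 1) rfl
  let e : E (Q.obj F.complex) (i - n) ≃ₗ[𝓀] E M (i - n) := E.congr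
    ((CategoryTheory.shiftFunctor (DerivedCategory (ModuleCat.{u} R)) (i - n)).mapIso F.iso)
  have := (F.hasBassSeries hM).1 (i - n)
  have : Module.Finite 𝓀 (E (F.triangle n).obj₂ (i - n)) := Module.Finite.equiv e.symm
  have : Module.Finite 𝓀 (E (F.triangle n).obj₁ (i - n + 1)) :=
    (F.finite_E_lower_and_bassNumber hasBassSeries_ringComplex n _).1
  have hfin : Module.Finite 𝓀 (E (Q.obj (F.upper n)) (i - n)) := hex.finite_of_finite
  refine ⟨Module.Finite.equiv (F.syzygyEquiv n i).symm, ?_⟩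
  rw [bassNumber, (F.syzygyEquiv n i).finrank_eq]
  exact (hex.finrank_eq hinj hsurj).trans (congrArg (· + _) e.finrank_eq)

lemma hasBassSeries_syzygy (hM : IsDfb M) (hU : ∀ i, F.U i = ⊥) (n : ℤ) :
    HasBassSeries (F.syzygy n) := by
  obtain ⟨a, ha⟩ := (F.hasBassSeries hM).2
  -- `i < a + n` kills the term from `M`, and `i < 0` the one from `F_{<n}`, which lives in degrees
  -- `≥ -n + 1`.
  refine ⟨fun i => (F.finite_E_syzygy_and_bassNumber hM hU n i).1, min (a + n) 0, fun i hi => ?_⟩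
  have := (F.finite_E_syzygy_and_bassNumber hM hU n i).1
  refine Module.finrank_zero_iff.1 ((F.finite_E_syzygy_and_bassNumber hM hU n i).2.trans ?_)
  have := ha (i - n) (by lia)
  have := subsingleton_E_of_isGE (Q.obj (F.lower n)) (-n + 1) (i - n + 1) (by lia)
  rw [bassNumber, bassNumber, Module.finrank_zero_of_subsingleton,
    Module.finrank_zero_of_subsingleton]

end Noetherian

end MinimalFreeResolution

end LocalRing

end

/-! ### Comparison of coefficients -/

theorem mainTheorem11 (R : Type u) [CommRing R] [IsLocalRing R] [IsNoetherianRing R]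
    [HasDerivedCategory.{w} (ModuleCat.{u} R)]
    (M : DerivedCategory (ModuleCat.{u} R)) (hM : LocalRing.IsDfb M)
    (F : LocalRing.MinimalFreeResolution M) (hU : ∀ i : ℤ, F.U i = ⊥)
    (n : ℤ) (hn : LocalRing.infHomology M + 1 ≤ (n : WithTop ℤ)) :
    LocalRing.HasBassSeries M ∧ LocalRing.HasBassSeries (LocalRing.ringComplex R) ∧
      LocalRing.HasBassSeries (F.syzygy n) ∧ F.HasPoincareSeries ∧
      LocalRing.bassSeries (F.syzygy n) =
        LocalRing.tPow n * LocalRing.bassSeries M +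
          LocalRing.tPow (n - 1) * LocalRing.truncInv F.poincareSeries (n - 1) *
            LocalRing.bassSeries (LocalRing.ringComplex R) := by
  have hMB := F.hasBassSeries hM
  have hRB := LocalRing.hasBassSeries_ringComplex (R := R)
  have hSB := F.hasBassSeries_syzygy hM hU n
  refine ⟨hMB, hRB, hSB, F.hasPoincareSeries, ?_⟩
  ext i
  rw [HahnSeries.coeff_add, LocalRing.coeff_tPow_mul_truncInv_mul, HahnSeries.coeff_single_mul,
    one_mul, hSB.coeff_bassSeries, hMB.coeff_bassSeries,
    (F.finite_E_syzygy_and_bassNumber hM hU n i).2,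
    (F.finite_E_lower_and_bassNumber hRB n _).2, Nat.cast_add, Nat.cast_sum]
  congr 1
  refine Finset.sum_congr rfl fun j _ => ?_
  rw [F.coeff_poincareSeries, hRB.coeff_bassSeries, Nat.cast_mul,
    show i - (n - 1) + j = i - n + 1 + j by ring]
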